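/- **Setting.** Let $1\le N_B\le T_{tr}\le T$ be integers, $P_b>0$, $\sigma_u^2>0$, $0<\epsilon<1$, $\rho_b=P_b/\sigma_u^2$ and $\Lambda=T_{tr}P_b/N_B$. The downlink channel $\mathbf h_d\in\mathbb C^{1\times N_B}$ has i.i.d. $\mathcal{CN}(0,1)$ entries. The user observes $\mathbf y_d=\sqrt{\Lambda}\,\mathbf h_d\mathbf S_d+\mathbf n_d$, where $\mathbf S_d\in\mathbb C^{N_B\times T_{tr}}$ satisfies $\mathbf S_d\mathbf S_d^H=\mathbf I$ and $\mathbf n_d$ has i.i.d. $\mathcal{CN}(0,\sigma_u^2)$ entries and is independent of $\mathbf h_d$. The user forms the linear MMSE estimate $\hat{\mathbf h}_d=\frac{\sqrt\Lambda}{\Lambda+\sigma_u^2}\mathbf y_d\mathbf S_d^H$, with error $\hat{\mathbf e}_d=\mathbf h_d-\hat{\mathbf h}_d$. The base station, knowing $\hat{\mathbf h}_d$, beamforms with $\mathbf v=\hat{\mathbf h}_d^H/\|\hat{\mathbf h}_d\|$, so the user receives $\sqrt{P_b}\,\mathbf h_d\mathbf v u+n=\sqrt{P_b}\|\hat{\mathbf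 h}_d\|u+\hat n$ with $\hat n=\sqrt{P_b}\,\hat{\mathbf e}_d\mathbf v u+n$. Here $\mathbb E|u|^2=1$, $n\sim\mathcal{CN}(0,\sigma_u^2)$, and $u$, $n$ and $(\mathbf h_d,\mathbf n_d)$ are independent. Put $\gamma_d=P_b\|\hat{\mathbf h}_d\|^2/\mathrm{Var}(\hat n)$, $C(\gamma)=\log_2(1+\gamma)$ and $V(\gamma)=(\log_2 e)^2(1-(1+\gamma)^{-2})$. Let $Q^{-1}$ be the inverse of $Q(x)=\Pr(\mathcal N(0,1)>x)$. The lower bound on the data rate achieved by downlink channel training is $$R_d=\Big(1-\frac{T_{tr}}T\Big)\,\mathbb E\Big[C(\gamma_d)-\sqrt{\tfrac1T V(\gamma_d)}\;Q^{-1}(\epsilon)\Big].$$ **Theorem.** The entries of $\hat{\mathbf h}_d$ and $\hat{\mathbf e}_d$ have variances $\sigma^2_{\hat h_d}=\frac{\Lambda}{\Lambda+\sigma_u^2}$ and $\sigma^2_{\hat e_d}=\frac{\sigma_u^2}{\Lambda+\sigma_u^2}$. Let $$\gamma=\gamma^d_{\rm eff}=\frac{\rho_b\sigma^2_{\hat h_d}}{\rho_b\sigma^2_{\hat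 e_d}+1},$$ $$\Phi(\gamma,N_B)=\frac{e^{1/\gamma}}{\ln 2\;\Gamma(N_B)\,\gamma^{N_B}}\sum_{i=0}^{N_B-1}\binom{N_B-1}{i}(-1)^{N_B-1-i}\,G^{3,0}_{2,3}\Big(\begin{matrix}-i,-i\\0,-1-i,-1-i\end{matrix}\Big|\frac1\gamma\Big),$$ $$\Psi(\gamma,N_B,T)=\sqrt{\frac{2\pi}{T}}\,\frac{Q^{-1}(\epsilon)}{\Gamma(N_B)\ln 2}\,e^{-(N_B-1)}(N_B-1)^{N_B-\frac12}\sqrt{1-(1+\gamma(N_B-1))^{-2}},$$ where $G$ is Meijer's G-function. The expectations $\mathbb E[C(\gamma_d)]$ and $\mathbb E[\sqrt{V(\gamma_d)/T}\,Q^{-1}(\epsilon)]$ exist, and the capacity term is exactly $\mathbb E[C(\gamma_d)]=\Phi(\gamma^d_{\rm eff},N_B)$. The dispersion term is given by its Laplace approximation $\Psi$: there is an absolute constant $K>0$ such that, whenever $N_B\ge2$, there is a real $\delta$ with $|\delta|\le K/N_B$, $\ \mathbb E\big[\sqrt{V(\gamma_d)/T}\,Q^{-1}(\epsilon)\big]=(1+\delta)\,\Psi(\gamma^d_{\rm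 eff},N_B,T)$, and $$R_d=\Big(1-\frac{T_{tr}}{T}\Big)\Big[\Phi(\gamma^d_{\rm eff},N_B)-(1+\delta)\,\Psi(\gamma^d_{\rm eff},N_B,T)\Big].$$ Thus $R_d=(1-T_{tr}/T)\,[\Phi-\Psi]$ up to the relative error $O(1/N_B)$ of the Laplace approximation in $\Psi$, uniformly in all other parameters. -/

import Mathlib

open MeasureTheory ProbabilityTheory Matrix
open scoped NNReal ENNReal

noncomputable section

namespace ChannelTraining

/-! ### Meijer's G-function -/

/-- The Mellin–Barnes integrand of `G^{m,n}_{p,q}(z | a ; b)`: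
`∏_{j<m} Γ(b_j - s) ∏_{k<n} Γ(1 - a_k + s) / (∏_{j≥m} Γ(1 - b_j + s) ∏_{k≥n} Γ(a_k - s)) * z ^ s`. -/
def meijerGIntegrand {p q : ℕ} (m n : ℕ) (a : Fin p → ℂ) (b : Fin q → ℂ) (z s : ℂ) : ℂ :=
  ((∏ j : Fin q with j.val < m, Complex.Gamma (b j - s)) *
      ∏ k : Fin p with k.val < n, Complex.Gamma (1 - a k + s)) /
    ((∏ j : Fin q with m ≤ j.val, Complex.Gamma (1 - b j + s)) *
      ∏ k : Fin p with n ≤ k.val, Complex.Gamma (a k - s)) * z ^ s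

/-- The vertical line `Re s = c` separates the poles of the `Γ(b_j - s)`, `j < m` (to its right),
from the poles of the `Γ(1 - a_k + s)`, `k < n` (to its left). -/
def IsSeparatingLine {p q : ℕ} (m n : ℕ) (a : Fin p → ℂ) (b : Fin q → ℂ) (c : ℝ) : Prop :=
  (∀ j : Fin q, j.val < m → c < (b j).re) ∧ (∀ k : Fin p, k.val < n → (a k).re - 1 < c)

open Classical in
/-- Meijer's G-function `G^{m,n}_{p,q}(z | a ; b) = (1 / 2πi) ∫_L (integrand) ds`, the contour `L`
running from `-i∞` to `+i∞` and separating the two families of poles; here `L` is a vertical line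
`s = c + i t`, so that `ds / (2πi) = dt / (2π)`. The value does not depend on the choice
of the separating line, by Cauchy's theorem. (Junk value `0` if no vertical line separates.) -/
def meijerG {p q : ℕ} (m n : ℕ) (a : Fin p → ℂ) (b : Fin q → ℂ) (z : ℂ) : ℂ :=
  if h : ∃ c : ℝ, IsSeparatingLine m n a b c then
    (1 / (2 * (Real.pi : ℂ))) *
      ∫ t : ℝ, meijerGIntegrand m n a b z ((h.choose : ℂ) + (t : ℂ) * Complex.I)
  else 0

/-! ### Capacity, dispersion and the Q-function -/

/-- Channel capacity `C(γ) = log₂ (1 + γ)`. -/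
def capacity (γ : ℝ) : ℝ := Real.logb 2 (1 + γ)

/-- Channel dispersion `V(γ) = (log₂ e)² (1 - (1 + γ)⁻²)`. -/
def dispersion (γ : ℝ) : ℝ := (Real.logb 2 (Real.exp 1)) ^ 2 * (1 - ((1 + γ) ^ 2)⁻¹)

/-- The Gaussian Q-function: the upper tail probability of the standard normal law. -/
def gaussQ (x : ℝ) : ℝ := (gaussianReal 0 1).real (Set.Ioi x)

/-- The inverse Q-function; it is the true inverse of the bijection `gaussQ : ℝ → (0, 1)` on
`(0, 1)`. -/
def gaussQInv (ε : ℝ) : ℝ := Function.invFun gaussQ ε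

/-! ### The closed-form functions -/

/-- `Φ(γ, N)`, the closed form of the capacity term. (Complex-valued, as Meijer's G is.) -/
def Phi (γ : ℝ) (N : ℕ) : ℂ :=
  ((Real.exp (1 / γ) / (Real.log 2 * Real.Gamma N * γ ^ N) : ℝ) : ℂ) *
    ∑ i ∈ Finset.range N, ((N - 1).choose i : ℂ) * (-1) ^ (N - 1 - i) *
      meijerG 3 0 ![-(i : ℂ), -(i : ℂ)] ![0, -1 - (i : ℂ), -1 - (i : ℂ)] ((1 / γ : ℝ) : ℂ)

/-- `Ψ(γ, N, T)` (at error probability `ε`), the Laplace approximation of the dispersion term. -/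
def Psi (ε : ℝ) (γ : ℝ) (N T : ℕ) : ℝ :=
  Real.sqrt (2 * Real.pi / T) * (gaussQInv ε / (Real.Gamma N * Real.log 2)) *
    Real.exp (-((N : ℝ) - 1)) * ((N : ℝ) - 1) ^ ((N : ℝ) - 1 / 2) *
    Real.sqrt (1 - ((1 + γ * ((N : ℝ) - 1)) ^ 2)⁻¹)

/-! ### Random model of downlink training and data transmission -/

/-- The circularly symmetric complex Gaussian law `CN(0, v)`: independent real and imaginary
parts, each `N(0, v / 2)`. -/
def complexGaussian (v : ℝ≥0) : Measure ℂ :=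
  ((gaussianReal 0 (v / 2)).prod (gaussianReal 0 (v / 2))).map
    (fun p : ℝ × ℝ => (⟨p.1, p.2⟩ : ℂ))

/-- Variance `E|X - E X|²` of a complex random variable. -/
def complexVariance {Ω : Type*} [MeasurableSpace Ω] (X : Ω → ℂ) (μ : Measure Ω) : ℝ :=
  ∫ ω, ‖X ω - ∫ ω', X ω' ∂μ‖ ^ 2 ∂μ

/-- The squared Euclidean norm of a complex vector. -/
def sqNorm {N : ℕ} (x : Fin N → ℂ) : ℝ := ∑ j, ‖x j‖ ^ 2

/-- `Λ = T_tr P_b / N_B`. -/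
def pilotPower (N Ttr : ℕ) (P : ℝ) : ℝ := Ttr * P / N

/-- The received training signal `y_d = √Λ h_d S_d + n_d` at the user. -/
def trainingSignal {N Ttr : ℕ} (P : ℝ) (S : Matrix (Fin N) (Fin Ttr) ℂ)
    (h : Fin N → ℂ) (nd : Fin Ttr → ℂ) : Fin Ttr → ℂ :=
  ((Real.sqrt (pilotPower N Ttr P) : ℝ) : ℂ) • (h ᵥ* S) + nd

/-- The linear MMSE estimate `ĥ_d = (√Λ / (Λ + σ_u²)) y_d S_dᴴ`. -/
def estimate {N Ttr : ℕ} (P : ℝ) (σsq : ℝ≥0) (S : Matrix (Fin N) (Fin Ttr) ℂ)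
    (h : Fin N → ℂ) (nd : Fin Ttr → ℂ) : Fin N → ℂ :=
  ((Real.sqrt (pilotPower N Ttr P) / (pilotPower N Ttr P + σsq) : ℝ) : ℂ) •
    (trainingSignal P S h nd ᵥ* Sᴴ)

/-- The estimation error `ê_d = h_d - ĥ_d`. -/
def estimationError {N Ttr : ℕ} (P : ℝ) (σsq : ℝ≥0) (S : Matrix (Fin N) (Fin Ttr) ℂ)
    (h : Fin N → ℂ) (nd : Fin Ttr → ℂ) : Fin N → ℂ :=
  h - estimate P σsq S h nd

/-- The normalized beamforming vector matched to the estimated channel `x`, i.e. the column vector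
`xᴴ / ‖x‖`, for which `x v = ‖x‖`. -/
def beamformer {N : ℕ} (x : Fin N → ℂ) : Fin N → ℂ :=
  fun j => (starRingEnd ℂ) (x j) / ((Real.sqrt (sqNorm x) : ℝ) : ℂ)

/-- The effective noise `n̂ = √P_b ê_d v u + n` during data transmission: the received symbol is
`√P_b h_d v u + n = √P_b ‖ĥ_d‖ u + n̂`. -/
def effectiveNoise {N Ttr : ℕ} (P : ℝ) (σsq : ℝ≥0) (S : Matrix (Fin N) (Fin Ttr) ℂ)
    (h : Fin N → ℂ) (nd : Fin Ttr → ℂ) (u n : ℂ) : ℂ :=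
  ((Real.sqrt P : ℝ) : ℂ) *
    (estimationError P σsq S h nd ⬝ᵥ beamformer (estimate P σsq S h nd)) * u + n

/-- The random model: channel `h` with i.i.d. `CN(0,1)` entries, training noise `nd` with i.i.d.
`CN(0, σ_u²)` entries, information symbol `u` of unit average power and receiver noise
`n ~ CN(0, σ_u²)`, all independent; pilot matrix `S` with orthonormal rows. -/
structure IsDownlinkModel {Ω : Type*} [MeasurableSpace Ω] (μ : Measure Ω) {N Ttr : ℕ} (σsq : ℝ≥0)
    (S : Matrix (Fin N) (Fin Ttr) ℂ) (h : Ω → Fin N → ℂ) (nd : Ω → Fin Ttr → ℂ)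
    (u n : Ω → ℂ) : Prop where
  pilots : S * Sᴴ = 1
  law_h : HasLaw h (Measure.pi fun _ => complexGaussian 1) μ
  law_nd : HasLaw nd (Measure.pi fun _ => complexGaussian σsq) μ
  law_n : HasLaw n (complexGaussian σsq) μ
  meas_u : AEMeasurable u μ
  power_u : ∫ ω, ‖u ω‖ ^ 2 ∂μ = 1
  indep_nd : IndepFun h nd μ
  indep_u : IndepFun (fun ω => (h ω, nd ω)) u μ
  indep_n : IndepFun (fun ω => (h ω, nd ω, u ω)) n μ

/-- The SINR `γ_d = P_b ‖ĥ_d‖² / Var(n̂)` at the user, as a random variable. -/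
def sinr {Ω : Type*} [MeasurableSpace Ω] (μ : Measure Ω) {N Ttr : ℕ} (P : ℝ) (σsq : ℝ≥0)
    (S : Matrix (Fin N) (Fin Ttr) ℂ) (h : Ω → Fin N → ℂ) (nd : Ω → Fin Ttr → ℂ)
    (u n : Ω → ℂ) (ω : Ω) : ℝ :=
  P * sqNorm (estimate P σsq S (h ω) (nd ω)) /
    complexVariance (fun ω' => effectiveNoise P σsq S (h ω') (nd ω') (u ω') (n ω')) μ

/-- The lower bound on the data rate of downlink training,
`R_d = (1 - T_tr / T) E[C(γ_d) - √(V(γ_d) / T) Q⁻¹(ε)]`. -/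
def downlinkRate {Ω : Type*} [MeasurableSpace Ω] (μ : Measure Ω) {N Ttr : ℕ} (T : ℕ) (ε : ℝ)
    (P : ℝ) (σsq : ℝ≥0) (S : Matrix (Fin N) (Fin Ttr) ℂ) (h : Ω → Fin N → ℂ)
    (nd : Ω → Fin Ttr → ℂ) (u n : Ω → ℂ) : ℝ :=
  (1 - (Ttr : ℝ) / T) *
    ∫ ω, (capacity (sinr μ P σsq S h nd u n ω) -
      Real.sqrt (1 / (T : ℝ) * dispersion (sinr μ P σsq S h nd u n ω)) * gaussQInv ε) ∂μ

/-- `σ²_ĥ = Λ / (Λ + σ_u²)`. -/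
def estimateVar (N Ttr : ℕ) (P : ℝ) (σsq : ℝ≥0) : ℝ :=
  pilotPower N Ttr P / (pilotPower N Ttr P + σsq)

/-- `σ²_ê = σ_u² / (Λ + σ_u²)`. -/
def errorVar (N Ttr : ℕ) (P : ℝ) (σsq : ℝ≥0) : ℝ :=
  σsq / (pilotPower N Ttr P + σsq)

/-- The effective SNR `γ_eff = ρ_b σ²_ĥ / (ρ_b σ²_ê + 1)`, where `ρ_b = P_b / σ_u²`. -/
def effectiveSNR (N Ttr : ℕ) (P : ℝ) (σsq : ℝ≥0) : ℝ :=
  (P / σsq) * estimateVar N Ttr P σsq / ((P / σsq) * errorVar N Ttr P σsq + 1)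

end ChannelTraining

end

open ChannelTraining

/-! By the orthogonality principle the estimate and its error are independent complex Gaussian
vectors. The error seen through the beamformer is therefore `CN(0, σ²_ê)` whatever the beamformer
is, so the effective noise has variance `P σ²_ê + σ_u²` and `γ_d = γ_eff X` with `X` of law
`Gamma(N, 1)`.

Capacity: with `y = 1 + γ x` and the binomial expansion of `(y - 1) ^ (N - 1)`, the mean of
`log (1 + γ X)` becomes a combination of Laplace transforms at `1 / γ` of `y ^ i log y` on `(1, ∞)`.
The Mellin transform of such a Laplace transform is `Γ(w) / (w - 1 - i)²`, which at `w = -s` is the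
Mellin–Barnes integrand of `G^{3,0}_{2,3}` without its factor `z ^ s`, because
`Γ(-i - s) = (-1 - i - s) Γ(-1 - i - s)`; Mellin inversion concludes.

Dispersion: `f(x) = √(1 - (1 + γ x)⁻²)` lies below its tangent at `N` and above that tangent
minus `(3/2) f(N) (x / N - 1)²`. Since `N` is both the mean and the variance of `X`, the mean of
`f(X)` is `f(N)` up to a relative error `O(1 / N)`. Moving from the mean `N` to the mode `N - 1` of
the Gamma density and applying Stirling's formula to `Γ(N)` each cost another factor
`1 + O(1 / N)`, and all these bounds are uniform in `γ`. -/

noncomputable section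

namespace ChannelTraining

section ComplexGaussian

variable {N M : ℕ} (v : ℝ≥0)

lemma norm_sq_complexMk (x y : ℝ) : ‖(⟨x, y⟩ : ℂ)‖ ^ 2 = x ^ 2 + y ^ 2 := by
  rw [← Complex.normSq_eq_norm_sq, Complex.normSq_mk, sq, sq]

lemma complexGaussian_eq_map_equivRealProdCLM :
    complexGaussian v = ((gaussianReal 0 (v / 2)).prod (gaussianReal 0 (v / 2))).map
      Complex.equivRealProdCLM.symm := rfl

instance : IsGaussian (complexGaussian v) := by
  rw [complexGaussian_eq_map_equivRealProdCLM]
  infer_instance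

lemma integral_complexGaussian {E : Type*} [NormedAddCommGroup E] [NormedSpace ℝ E] {f : ℂ → E}
    (hf : Continuous f) :
    ∫ z, f z ∂complexGaussian v
      = ∫ p : ℝ × ℝ, f ⟨p.1, p.2⟩ ∂(gaussianReal 0 (v / 2)).prod (gaussianReal 0 (v / 2)) :=
  integral_map Complex.equivRealProdCLM.symm.continuous.aemeasurable
    hf.stronglyMeasurable.aestronglyMeasurable

lemma integral_id_complexGaussian : ∫ z, z ∂complexGaussian v = 0 := by
  have hmean : ∫ p, p ∂(gaussianReal 0 (v / 2)).prod (gaussianReal 0 (v / 2)) = 0 := by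
    apply Prod.ext
    · rw [fst_integral IsGaussian.integrable_id, integral_fun_fst (fun x : ℝ ↦ x)]
      simp
    · rw [snd_integral IsGaussian.integrable_id, integral_fun_snd (fun x : ℝ ↦ x)]
      simp
  rw [complexGaussian_eq_map_equivRealProdCLM, ContinuousLinearEquiv.integral_id_map, hmean,
    map_zero]

lemma integral_norm_sq_complexGaussian : ∫ z, ‖z‖ ^ 2 ∂complexGaussian v = v := by
  have hint : Integrable (fun x : ℝ ↦ x ^ 2) (gaussianReal 0 (v / 2)) :=
    (memLp_id_gaussianReal' 2 (by simp)).integrable_sq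
  have hsq : ∫ x, x ^ 2 ∂gaussianReal 0 (v / 2) = v / 2 := by
    have hvar := variance_id_gaussianReal (μ := 0) (v := v / 2)
    rw [variance_eq_integral (by fun_prop)] at hvar
    simpa using hvar
  rw [integral_complexGaussian v (by fun_prop)]
  simp only [norm_sq_complexMk]
  rw [integral_add (hint.comp_fst _) (hint.comp_snd _), integral_fun_fst (fun x : ℝ ↦ x ^ 2),
    integral_fun_snd (fun x : ℝ ↦ x ^ 2), hsq]
  simp

lemma charFun_complexGaussian (t : ℂ) :
    charFun (complexGaussian v) t = Complex.exp (-(v / 4) * (‖t‖ ^ 2 : ℝ)) := by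
  have hsplit (p : ℝ × ℝ) : Complex.exp (inner ℝ (⟨p.1, p.2⟩ : ℂ) t * Complex.I)
      = Complex.exp (t.re * p.1 * Complex.I) * Complex.exp (t.im * p.2 * Complex.I) := by
    rw [← Complex.exp_add, Complex.inner, Complex.mul_re]
    simp only [Complex.conj_re, Complex.conj_im, Complex.ofReal_sub, Complex.ofReal_mul,
      Complex.ofReal_neg]
    ring_nf
  rw [charFun_apply, integral_complexGaussian v (by fun_prop)]
  simp_rw [hsplit]
  rw [integral_prod_mul (fun x : ℝ ↦ Complex.exp (t.re * x * Complex.I))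
    (fun x : ℝ ↦ Complex.exp (t.im * x * Complex.I)), ← charFun_apply_real, ← charFun_apply_real,
    charFun_gaussianReal, charFun_gaussianReal, ← Complex.exp_add,
    norm_sq_complexMk t.re t.im]
  push_cast
  ring_nf

lemma sqNorm_nonneg (x : Fin N → ℂ) : 0 ≤ sqNorm x :=
  Finset.sum_nonneg fun _ _ ↦ by positivity

@[fun_prop]
lemma measurable_sqNorm : Measurable (sqNorm : (Fin N → ℂ) → ℝ) := by
  unfold sqNorm
  fun_prop

lemma sqNorm_smul (c : ℂ) (x : Fin N → ℂ) : sqNorm (c • x) = ‖c‖ ^ 2 * sqNorm x := by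
  simp [sqNorm, mul_pow, Finset.mul_sum]

lemma ofReal_sqNorm (x : Fin N → ℂ) : ((sqNorm x : ℝ) : ℂ) = star x ⬝ᵥ x := by
  simp [sqNorm, dotProduct, Complex.conj_mul']

lemma sqNorm_conjTranspose_mulVec {S : Matrix (Fin N) (Fin M) ℂ} (hS : S * Sᴴ = 1)
    (w : Fin N → ℂ) : sqNorm (Sᴴ *ᵥ w) = sqNorm w := by
  rw [← Complex.ofReal_inj, ofReal_sqNorm, ofReal_sqNorm, star_mulVec, conjTranspose_conjTranspose,
    ← dotProduct_mulVec, mulVec_mulVec, hS, one_mulVec]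

/-- The real functional `x ↦ Re (a ⬝ x)` on `ℂⁿ`; the characteristic functions of random complex
vectors are evaluated at these functionals. -/
def reDotProduct (a : Fin N → ℂ) : StrongDual ℝ (Fin N → ℂ) :=
  LinearMap.toContinuousLinearMap
    (Complex.reLm ∘ₗ (dotProductBilin ℂ ℂ a).restrictScalars ℝ)

@[simp]
lemma reDotProduct_apply (a x : Fin N → ℂ) : reDotProduct a x = (a ⬝ᵥ x).re := rfl

lemma exists_eq_reDotProduct (L : StrongDual ℝ (Fin N → ℂ)) : ∃ a, L = reDotProduct a := by
  refine ⟨fun j ↦ ⟨L (Pi.single j 1), -L (Pi.single j Complex.I)⟩, ?_⟩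
  ext x
  have hx : x = ∑ j, ((x j).re • (Pi.single j 1 : Fin N → ℂ)
      + (x j).im • (Pi.single j Complex.I : Fin N → ℂ)) := by
    ext k
    simp [Finset.sum_apply, Pi.single_apply, Finset.sum_add_distrib]
  conv_lhs => rw [hx]
  simp [dotProduct, Complex.re_sum, Complex.mul_re, mul_comm]

lemma charFunDual_pi_complexGaussian (a : Fin N → ℂ) :
    charFunDual (Measure.pi fun _ ↦ complexGaussian v) (reDotProduct a)
      = Complex.exp (-(v / 4) * sqNorm a) := by
  have hsingle (j : Fin N) : (reDotProduct a).comp (.single ℝ (fun _ ↦ ℂ) j)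
      = InnerProductSpace.toDualMap ℝ ℂ (starRingEnd ℂ (a j)) := by
    ext
    simp [Complex.inner, mul_comm]
  simp_rw [charFunDual_pi, hsingle, ← charFun_eq_charFunDual_toDualMap, charFun_complexGaussian,
    RCLike.norm_conj, ← Complex.exp_sum, ← Finset.mul_sum, ← Complex.ofReal_sum]
  rfl

lemma map_dotProduct_complexGaussian {w : ℝ≥0} {a : Fin N → ℂ} (hw : w = v * sqNorm a) :
    (Measure.pi fun _ ↦ complexGaussian v).map (· ⬝ᵥ a) = complexGaussian w := by
  have hm : Measurable fun x : Fin N → ℂ ↦ x ⬝ᵥ a := by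
    unfold dotProduct
    fun_prop
  have := Measure.isProbabilityMeasure_map (μ := Measure.pi fun _ : Fin N ↦ complexGaussian v)
    hm.aemeasurable
  refine Measure.ext_of_charFun (funext fun t ↦ ?_)
  have hinner (x : Fin N → ℂ) :
      inner ℝ (x ⬝ᵥ a) t = reDotProduct (starRingEnd ℂ t • a) x := by
    rw [reDotProduct_apply, smul_dotProduct, dotProduct_comm a x, smul_eq_mul, Complex.inner,
      ← Complex.conj_re, map_mul, Complex.conj_conj, mul_comm]
  rw [charFun_apply, integral_map hm.aemeasurable (by fun_prop)]
  simp_rw [hinner]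
  rw [← charFunDual_apply, charFunDual_pi_complexGaussian, charFun_complexGaussian, sqNorm_smul,
    RCLike.norm_conj, show (w : ℂ) = v * sqNorm a from mod_cast congrArg Complex.ofReal hw]
  push_cast
  ring_nf

lemma exists_eq_coprod_reDotProduct (L : StrongDual ℝ ((Fin N → ℂ) × (Fin M → ℂ))) :
    ∃ a b, L = (reDotProduct a).coprod (reDotProduct b) := by
  obtain ⟨a, ha⟩ := exists_eq_reDotProduct (L.comp (.inl ℝ _ _))
  obtain ⟨b, hb⟩ := exists_eq_reDotProduct (L.comp (.inr ℝ _ _))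
  exact ⟨a, b, by rw [← ha, ← hb, ContinuousLinearMap.coprod_comp_inl_inr]⟩

lemma charFunDual_prod_pi_complexGaussian (w : ℝ≥0) (a : Fin N → ℂ) (b : Fin M → ℂ) :
    charFunDual ((Measure.pi fun _ ↦ complexGaussian v).prod
        (Measure.pi fun _ ↦ complexGaussian w)) ((reDotProduct a).coprod (reDotProduct b))
      = Complex.exp (-((v * sqNorm a + w * sqNorm b : ℝ) / 4)) := by
  rw [charFunDual_prod, ContinuousLinearMap.coprod_comp_inl, ContinuousLinearMap.coprod_comp_inr,
    charFunDual_pi_complexGaussian, charFunDual_pi_complexGaussian, ← Complex.exp_add]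
  push_cast
  ring_nf

lemma norm_sq_add_mul_norm_sub_sq {κ η : ℝ} (h : κ + η = 1) (a b : ℂ) :
    ‖κ * a + η * b‖ ^ 2 + κ * η * ‖a - b‖ ^ 2 = κ * ‖a‖ ^ 2 + η * ‖b‖ ^ 2 := by
  obtain rfl : η = 1 - κ := by linarith
  simp only [← Complex.normSq_eq_norm_sq, Complex.normSq_apply, Complex.add_re, Complex.add_im,
    Complex.sub_re, Complex.sub_im, Complex.re_ofReal_mul, Complex.im_ofReal_mul]
  ring

lemma sqNorm_add_mul_sqNorm_sub {κ η : ℝ} (h : κ + η = 1) (a b : Fin N → ℂ) :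
    sqNorm ((κ : ℂ) • a + (η : ℂ) • b) + κ * η * sqNorm (a - b)
      = κ * sqNorm a + η * sqNorm b := by
  simp only [sqNorm, Finset.mul_sum, ← Finset.sum_add_distrib]
  exact Finset.sum_congr rfl fun j _ ↦ norm_sq_add_mul_norm_sub_sq h (a j) (b j)

lemma dotProduct_vecMul_conjTranspose (S : Matrix (Fin N) (Fin M) ℂ) (a : Fin N → ℂ)
    (y : Fin M → ℂ) : a ⬝ᵥ (y ᵥ* Sᴴ) = (Sᴴ *ᵥ a) ⬝ᵥ y := by
  rw [dotProduct_comm, ← dotProduct_mulVec, dotProduct_comm]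

-- Orthogonality principle: `s c² = κ η` cancels the cross term `a ⬝ b` in the joint
-- characteristic function, which therefore factors.
lemma map_prod_complexGaussian_eq_prod {S : Matrix (Fin N) (Fin M) ℂ} (hS : S * Sᴴ = 1)
    {κ η s : ℝ≥0} {c : ℝ} (hκη : (κ : ℝ) + η = 1) (hc : s * c ^ 2 = (κ : ℝ) * η) :
    ((Measure.pi fun _ ↦ complexGaussian 1).prod (Measure.pi fun _ ↦ complexGaussian s)).map
        (fun p ↦ ((κ : ℂ) • p.1 + (c : ℂ) • (p.2 ᵥ* Sᴴ), (η : ℂ) • p.1 - (c : ℂ) • (p.2 ᵥ* Sᴴ)))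
      = (Measure.pi fun _ ↦ complexGaussian κ).prod (Measure.pi fun _ ↦ complexGaussian η) := by
  have hm : Measurable fun p : (Fin N → ℂ) × (Fin M → ℂ) ↦
      ((κ : ℂ) • p.1 + (c : ℂ) • (p.2 ᵥ* Sᴴ), (η : ℂ) • p.1 - (c : ℂ) • (p.2 ᵥ* Sᴴ)) := by
    have : Measurable fun x : Fin M → ℂ ↦ x ᵥ* Sᴴ := by
      unfold vecMul dotProduct
      fun_prop
    fun_prop
  have := Measure.isProbabilityMeasure_map
    (μ := (Measure.pi fun _ ↦ complexGaussian 1).prod (Measure.pi fun _ ↦ complexGaussian s))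
    hm.aemeasurable
  refine Measure.ext_of_charFunDual (funext fun L ↦ ?_)
  obtain ⟨a, b, rfl⟩ := exists_eq_coprod_reDotProduct L
  have hadjoint (p : (Fin N → ℂ) × (Fin M → ℂ)) :
      (reDotProduct a).coprod (reDotProduct b)
          ((κ : ℂ) • p.1 + (c : ℂ) • (p.2 ᵥ* Sᴴ), (η : ℂ) • p.1 - (c : ℂ) • (p.2 ᵥ* Sᴴ))
        = (reDotProduct ((κ : ℂ) • a + (η : ℂ) • b)).coprod
            (reDotProduct ((c : ℂ) • (Sᴴ *ᵥ (a - b)))) p := by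
    simp only [ContinuousLinearMap.coprod_apply, reDotProduct_apply, ← Complex.add_re,
      dotProduct_add, dotProduct_sub, dotProduct_smul, add_dotProduct, smul_dotProduct,
      sub_dotProduct, mulVec_sub, dotProduct_vecMul_conjTranspose, smul_eq_mul]
    ring_nf
  have hnorm : (1 : ℝ≥0) * sqNorm ((κ : ℂ) • a + (η : ℂ) • b)
      + s * sqNorm ((c : ℂ) • (Sᴴ *ᵥ (a - b))) = κ * sqNorm a + η * sqNorm b := by
    rw [sqNorm_smul, sqNorm_conjTranspose_mulVec hS, Complex.norm_real, Real.norm_eq_abs, sq_abs,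
      ← mul_assoc, hc, NNReal.coe_one, one_mul]
    exact sqNorm_add_mul_sqNorm_sub hκη a b
  rw [charFunDual_apply, integral_map hm.aemeasurable (by fun_prop)]
  simp_rw [hadjoint]
  rw [← charFunDual_apply, charFunDual_prod_pi_complexGaussian, hnorm,
    charFunDual_prod_pi_complexGaussian]

end ComplexGaussian

section ComplexVariance

variable {Ω : Type*} [MeasurableSpace Ω] {μ : Measure Ω} {X Y : Ω → ℂ} {v : ℝ≥0}

lemma complexVariance_const_mul (c : ℂ) :
    complexVariance (fun ω ↦ c * X ω) μ = ‖c‖ ^ 2 * complexVariance X μ := by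
  simp_rw [complexVariance, integral_const_mul, ← mul_sub, norm_mul, mul_pow, integral_const_mul]

lemma complexVariance_eq_variance_re_add_variance_im [IsFiniteMeasure μ] (hX : MemLp X 2 μ) :
    complexVariance X μ
      = variance (fun ω ↦ (X ω).re) μ + variance (fun ω ↦ (X ω).im) μ := by
  have hint : Integrable X μ := hX.integrable one_le_two
  have hre : ∫ ω, (X ω).re ∂μ = (∫ ω, X ω ∂μ).re := integral_re hint
  have him : ∫ ω, (X ω).im ∂μ = (∫ ω, X ω ∂μ).im := integral_im hint
  have hre2 : MemLp (fun ω ↦ (X ω).re - (∫ ω', X ω' ∂μ).re) 2 μ := hX.re.sub (memLp_const _)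
  have him2 : MemLp (fun ω ↦ (X ω).im - (∫ ω', X ω' ∂μ).im) 2 μ := hX.im.sub (memLp_const _)
  rw [variance_eq_integral (X := fun ω ↦ (X ω).re) hX.re.aemeasurable,
    variance_eq_integral (X := fun ω ↦ (X ω).im) hX.im.aemeasurable, hre, him,
    ← integral_add hre2.integrable_sq him2.integrable_sq]
  exact integral_congr_ae (.of_forall fun ω ↦ norm_sq_complexMk _ _)

lemma complexVariance_add [IsFiniteMeasure μ] (hX : MemLp X 2 μ) (hY : MemLp Y 2 μ)
    (hXY : IndepFun X Y μ) :
    complexVariance (fun ω ↦ X ω + Y ω) μ = complexVariance X μ + complexVariance Y μ := by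
  have hre := IndepFun.variance_fun_add hX.re hY.re
    (hXY.comp Complex.measurable_re Complex.measurable_re)
  have him := IndepFun.variance_fun_add hX.im hY.im
    (hXY.comp Complex.measurable_im Complex.measurable_im)
  simp only [RCLike.re_eq_complex_re, RCLike.im_eq_complex_im] at hre him
  rw [complexVariance_eq_variance_re_add_variance_im hX,
    complexVariance_eq_variance_re_add_variance_im hY,
    complexVariance_eq_variance_re_add_variance_im (X := fun ω ↦ X ω + Y ω) (hX.add hY)]
  simp only [Complex.add_re, Complex.add_im, hre, him]
  ring

lemma indepFun_norm_sq (hXY : IndepFun X Y μ) :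
    IndepFun (fun ω ↦ ‖X ω‖ ^ 2) (fun ω ↦ ‖Y ω‖ ^ 2) μ :=
  hXY.comp (φ := fun z ↦ ‖z‖ ^ 2) (ψ := fun z ↦ ‖z‖ ^ 2) (by fun_prop) (by fun_prop)

lemma memLp_two_mul_of_indepFun (hX : MemLp X 2 μ) (hY : MemLp Y 2 μ) (hXY : IndepFun X Y μ) :
    MemLp (fun ω ↦ X ω * Y ω) 2 μ := by
  refine (memLp_two_iff_integrable_sq_norm (hX.1.mul hY.1)).2 ?_
  simp only [Pi.mul_apply, norm_mul, mul_pow]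
  exact (indepFun_norm_sq hXY).integrable_mul ((memLp_two_iff_integrable_sq_norm hX.1).1 hX)
    ((memLp_two_iff_integrable_sq_norm hY.1).1 hY)

lemma complexVariance_mul_of_indepFun (hX : AEStronglyMeasurable X μ)
    (hY : AEStronglyMeasurable Y μ) (hXY : IndepFun X Y μ) (hX0 : ∫ ω, X ω ∂μ = 0) :
    complexVariance (fun ω ↦ X ω * Y ω) μ = complexVariance X μ * ∫ ω, ‖Y ω‖ ^ 2 ∂μ := by
  have hmean : ∫ ω, X ω * Y ω ∂μ = 0 := by
    rw [hXY.integral_fun_mul_eq_mul_integral hX hY, hX0, zero_mul]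
  simp_rw [complexVariance, hmean, hX0, sub_zero, norm_mul, mul_pow]
  exact (indepFun_norm_sq hXY).integral_fun_mul_eq_mul_integral (hX.norm.pow 2) (hY.norm.pow 2)

lemma memLp_two_of_hasLaw_complexGaussian (hX : HasLaw X (complexGaussian v) μ) :
    MemLp X 2 μ := by
  have hid : MemLp id 2 (μ.map X) := hX.map_eq ▸ IsGaussian.memLp_two_id
  exact hid.comp_of_map hX.aemeasurable

lemma integral_of_hasLaw_complexGaussian (hX : HasLaw X (complexGaussian v) μ) :
    ∫ ω, X ω ∂μ = 0 :=
  hX.integral_eq.trans (integral_id_complexGaussian v)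

lemma complexVariance_of_hasLaw_complexGaussian (hX : HasLaw X (complexGaussian v) μ) :
    complexVariance X μ = v := by
  simp_rw [complexVariance, integral_of_hasLaw_complexGaussian hX, sub_zero]
  rw [← integral_norm_sq_complexGaussian v]
  exact hX.integral_comp (f := fun z ↦ ‖z‖ ^ 2) (by fun_prop)

end ComplexVariance

section GammaLaw

variable {Ω : Type*} [MeasurableSpace Ω] {μ : Measure Ω} {X : Ω → ℝ} {N : ℕ} {v w : ℝ≥0}
  {a r t : ℝ}

lemma ext_of_mgf_eventuallyEq {μ ν : Measure ℝ} [IsProbabilityMeasure μ] [IsProbabilityMeasure ν]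
    (h0 : 0 ∈ interior (integrableExpSet id μ)) (h : mgf id μ =ᶠ[nhds 0] mgf id ν) : μ = ν := by
  have h0' : 0 ∈ interior (integrableExpSet id ν) := by
    rw [mem_interior_iff_mem_nhds] at h0 ⊢
    filter_upwards [h0, h] with t ht heq
    rw [integrableExpSet, Set.mem_ofPred_eq, ← mgf_pos_iff] at ht ⊢
    rwa [← heq]
  let strip := {z : ℂ | z.re ∈ interior (integrableExpSet id μ) ∩ interior (integrableExpSet id ν)}
  have hstrip : Set.EqOn (complexMGF id μ) (complexMGF id ν) strip := by
    have hμ : AnalyticOnNhd ℂ (complexMGF id μ) strip :=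
      analyticOnNhd_complexMGF.mono fun z hz ↦ hz.1
    have hν : AnalyticOnNhd ℂ (complexMGF id ν) strip :=
      analyticOnNhd_complexMGF.mono fun z hz ↦ hz.2
    refine hμ.eqOn_of_preconnected_of_frequently_eq hν
      ((convex_integrableExpSet.interior.inter convex_integrableExpSet.interior).linear_preimage
        Complex.reLm).isPreconnected (z₀ := ((0 : ℝ) : ℂ))
      ⟨by simpa using h0, by simpa using h0'⟩ ?_
    have hreal : ∃ᶠ x : ℝ in nhdsWithin 0 {0}ᶜ, complexMGF id μ x = complexMGF id ν x := by
      refine (Filter.Eventually.frequently ?_)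
      filter_upwards [nhdsWithin_le_nhds h] with x hx
      rw [complexMGF_ofReal, complexMGF_ofReal, hx]
    have htend : Filter.Tendsto ((↑) : ℝ → ℂ) (nhdsWithin 0 {0}ᶜ)
        (nhdsWithin ((0 : ℝ) : ℂ) {((0 : ℝ) : ℂ)}ᶜ) :=
      Complex.continuous_ofReal.continuousAt.continuousWithinAt.tendsto_nhdsWithin
        fun x hx ↦ by simpa using hx
    exact htend.frequently hreal
  refine Measure.ext_of_charFun (funext fun t ↦ ?_)
  rw [← complexMGF_id_mul_I, ← complexMGF_id_mul_I]
  exact hstrip ⟨by simpa using h0, by simpa using h0'⟩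

lemma integral_gammaMeasure {E : Type*} [NormedAddCommGroup E] [NormedSpace ℝ E]
    (ha : 0 < a) (hr : 0 < r) (f : ℝ → E) :
    ∫ x, f x ∂gammaMeasure a r
      = ∫ x in Set.Ioi (0 : ℝ),
          (r ^ a / Real.Gamma a * x ^ (a - 1) * Real.exp (-(r * x))) • f x := by
  rw [gammaMeasure, integral_withDensity_eq_integral_toReal_smul (f := gammaPDF a r)
    (measurable_gammaPDFReal a r).ennreal_ofReal (ae_of_all _ fun _ ↦ ENNReal.ofReal_lt_top),
    ← integral_Ici_eq_integral_Ioi, ← integral_indicator measurableSet_Ici]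
  congr with x
  simp only [gammaPDF, ENNReal.toReal_ofReal (gammaPDFReal_nonneg ha hr x)]
  by_cases hx : 0 ≤ x <;> simp [gammaPDFReal, hx]

lemma ae_nonneg_gammaMeasure (a r : ℝ) : ∀ᵐ x ∂gammaMeasure a r, 0 ≤ x := by
  have hm : Measurable (gammaPDF a r) := (measurable_gammaPDFReal a r).ennreal_ofReal
  rw [gammaMeasure, ae_withDensity_iff hm]
  refine ae_of_all _ fun x hx ↦ ?_
  by_contra! hneg
  exact hx (gammaPDF_of_neg hneg)

lemma integral_pow_gammaMeasure (ha : 0 < a) (hr : 0 < r) (k : ℕ) :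
    ∫ x, x ^ k ∂gammaMeasure a r = Real.Gamma (a + k) / (Real.Gamma a * r ^ k) := by
  have hpow : ∀ x ∈ Set.Ioi (0 : ℝ),
      (r ^ a / Real.Gamma a * x ^ (a - 1) * Real.exp (-(r * x))) • x ^ k
        = r ^ a / Real.Gamma a * (x ^ (a + k - 1) * Real.exp (-(r * x))) := by
    intro x hx
    rw [show a + k - 1 = a - 1 + k by ring, Real.rpow_add_natCast (Set.mem_Ioi.1 hx).ne',
      smul_eq_mul]
    ring
  rw [integral_gammaMeasure ha hr, setIntegral_congr_fun measurableSet_Ioi hpow,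
    integral_const_mul, Real.integral_rpow_mul_exp_neg_mul_Ioi (by positivity) hr,
    Real.rpow_add_natCast (by positivity), one_div, Real.inv_rpow hr.le, inv_pow]
  field_simp

lemma integrable_pow_gammaMeasure (ha : 0 < a) (hr : 0 < r) (k : ℕ) :
    Integrable (fun x ↦ x ^ k) (gammaMeasure a r) := by
  refine .of_integral_ne_zero ?_
  rw [integral_pow_gammaMeasure ha hr]
  positivity

lemma memLp_id_gammaMeasure (ha : 0 < a) (hr : 0 < r) : MemLp id 2 (gammaMeasure a r) :=
  (memLp_two_iff_integrable_sq aestronglyMeasurable_id).2 (integrable_pow_gammaMeasure ha hr 2)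

lemma integral_id_gammaMeasure (ha : 0 < a) (hr : 0 < r) :
    (gammaMeasure a r)[id] = a / r := by
  have h := integral_pow_gammaMeasure ha hr 1
  have hGamma := Real.Gamma_pos_of_pos ha
  simp only [pow_one, Nat.cast_one, Real.Gamma_add_one ha.ne'] at h
  rw [mul_comm (Real.Gamma a), mul_div_mul_right _ _ hGamma.ne'] at h
  exact h

lemma variance_id_gammaMeasure (ha : 0 < a) (hr : 0 < r) :
    Var[id; gammaMeasure a r] = a / r ^ 2 := by
  have := isProbabilityMeasure_gammaMeasure ha hr
  have hsq : ∫ x, (id ^ 2) x ∂gammaMeasure a r = (a + 1) * a / r ^ 2 := by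
    have h := integral_pow_gammaMeasure ha hr 2
    rw [Nat.cast_two, show a + 2 = a + 1 + 1 by ring, Real.Gamma_add_one (by positivity),
      Real.Gamma_add_one ha.ne'] at h
    simp only [Pi.pow_apply, id, h]
    field_simp
  rw [variance_eq_sub (memLp_id_gammaMeasure ha hr), hsq, integral_id_gammaMeasure ha hr]
  field_simp
  ring

lemma integrable_of_hasLaw_gammaMeasure (hX : HasLaw X (gammaMeasure a 1) μ) (ha : 0 < a) :
    Integrable X μ := by
  have := isProbabilityMeasure_gammaMeasure ha one_pos
  have hid := (memLp_id_gammaMeasure ha one_pos).integrable one_le_two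
  rw [← hX.map_eq] at hid
  exact hid.comp_aemeasurable hX.aemeasurable

lemma mgf_id_gammaMeasure (ha : 0 < a) (ht : t < r) (hr : 0 < r) :
    mgf id (gammaMeasure a r) t = (r / (r - t)) ^ a := by
  have hrt : 0 < r - t := sub_pos.2 ht
  calc mgf id (gammaMeasure a r) t
      = ∫ x in Set.Ioi (0 : ℝ),
          r ^ a / Real.Gamma a * (x ^ (a - 1) * Real.exp (-((r - t) * x))) := by
        rw [mgf, integral_gammaMeasure ha hr]
        congr with x
        rw [id, smul_eq_mul, show -((r - t) * x) = -(r * x) + t * x by ring, Real.exp_add]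
        ring
    _ = r ^ a / Real.Gamma a * ((1 / (r - t)) ^ a * Real.Gamma a) := by
        rw [integral_const_mul, Real.integral_rpow_mul_exp_neg_mul_Ioi ha hrt]
    _ = (r / (r - t)) ^ a := by
        rw [div_eq_mul_one_div r, Real.mul_rpow hr.le (by positivity)]
        field_simp [(Real.Gamma_pos_of_pos ha).ne']

lemma mgf_sq_gaussianReal (hv : v ≠ 0) (ht : 2 * v * t < 1) :
    mgf (fun x ↦ x ^ 2) (gaussianReal 0 v) t = (√(1 - 2 * v * t))⁻¹ := by
  have hdensity (x : ℝ) : gaussianPDFReal 0 v x • Real.exp (t * x ^ 2)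
      = (√(2 * Real.pi * v))⁻¹ * Real.exp (-((1 - 2 * v * t) / (2 * v)) * x ^ 2) := by
    rw [gaussianPDFReal, smul_eq_mul, mul_assoc, ← Real.exp_add]
    congr 2
    field_simp
    ring
  rw [mgf, integral_gaussianReal_eq_integral_smul hv]
  simp_rw [hdensity]
  rw [integral_const_mul, integral_gaussian, ← Real.sqrt_inv, ← Real.sqrt_mul (by positivity),
    ← Real.sqrt_inv]
  congr 1
  have : 1 - 2 * v * t ≠ 0 := by linarith
  field_simp

lemma mgf_norm_sq_complexGaussian (hv : v ≠ 0) (ht : v * t < 1) :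
    mgf (fun z ↦ ‖z‖ ^ 2) (complexGaussian v) t = (1 - v * t)⁻¹ := by
  have hsplit (p : ℝ × ℝ) : Real.exp (t * ‖(⟨p.1, p.2⟩ : ℂ)‖ ^ 2)
      = Real.exp (t * p.1 ^ 2) * Real.exp (t * p.2 ^ 2) := by
    rw [norm_sq_complexMk, mul_add, Real.exp_add]
  have hreal : ∫ x, Real.exp (t * x ^ 2) ∂gaussianReal 0 (v / 2) = (√(1 - v * t))⁻¹ := by
    have hv2 : 2 * (v / 2 : ℝ≥0) * t = v * t := by push_cast; ring
    have hmgf := mgf_sq_gaussianReal (v := v / 2) (t := t) (by positivity) (by rwa [hv2])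
    rwa [hv2] at hmgf
  rw [mgf, integral_complexGaussian v (by fun_prop)]
  simp_rw [hsplit]
  rw [integral_prod_mul (fun x : ℝ ↦ Real.exp (t * x ^ 2)) (fun x : ℝ ↦ Real.exp (t * x ^ 2)),
    hreal, ← mul_inv, Real.mul_self_sqrt (by linarith)]

lemma mgf_sqNorm (hv : v ≠ 0) (ht : v * t < 1) :
    mgf sqNorm (Measure.pi fun _ : Fin N ↦ complexGaussian v) t = ((1 - v * t)⁻¹) ^ N := by
  simp_rw [mgf, sqNorm, Finset.mul_sum, Real.exp_sum]
  rw [integral_fintype_prod_eq_prod (f := fun _ (z : ℂ) ↦ Real.exp (t * ‖z‖ ^ 2))]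
  simp_rw [← mgf_norm_sq_complexGaussian hv ht]
  simp [mgf]

lemma hasLaw_sqNorm_div (hN : 0 < N) (hv : v ≠ 0) :
    HasLaw (fun x ↦ sqNorm x / v) (gammaMeasure N 1)
      (Measure.pi fun _ : Fin N ↦ complexGaussian v) := by
  have hv0 : (v : ℝ) ≠ 0 := by positivity
  have hN0 : (0 : ℝ) < N := by exact_mod_cast hN
  have hm : AEMeasurable (fun x : Fin N → ℂ ↦ sqNorm x / v)
      (Measure.pi fun _ ↦ complexGaussian v) := by fun_prop
  have := isProbabilityMeasure_gammaMeasure hN0 one_pos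
  have := Measure.isProbabilityMeasure_map hm
  have hgamma {t : ℝ} (ht : t < 1) : mgf id (gammaMeasure N 1) t = ((1 - t)⁻¹) ^ N := by
    rw [mgf_id_gammaMeasure hN0 ht one_pos, one_div, Real.rpow_natCast]
  refine ⟨hm, (ext_of_mgf_eventuallyEq ?_ ?_).symm⟩
  · rw [mem_interior_iff_mem_nhds]
    filter_upwards [Iio_mem_nhds one_pos] with t ht
    rw [integrableExpSet, Set.mem_ofPred_eq, ← mgf_pos_iff, hgamma ht]
    have : 0 < 1 - t := sub_pos.2 ht
    positivity
  · filter_upwards [Iio_mem_nhds one_pos] with t ht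
    have hvt : v * ((v : ℝ)⁻¹ * t) = t := mul_inv_cancel_left₀ hv0 t
    simp_rw [mgf_id_map hm, div_eq_inv_mul]
    rw [mgf_const_mul, mgf_sqNorm hv (by rwa [hvt]), hvt, hgamma ht]

lemma ae_sqNorm_ne_zero (hN : 0 < N) (hv : v ≠ 0) :
    ∀ᵐ x ∂(Measure.pi fun _ : Fin N ↦ complexGaussian v), sqNorm x ≠ 0 := by
  have hgamma : ∀ᵐ y ∂gammaMeasure N 1, y ≠ 0 :=
    (withDensity_absolutelyContinuous _ _).ae_le (Measure.ae_ne volume 0)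
  rw [← (hasLaw_sqNorm_div hN hv).map_eq] at hgamma
  filter_upwards [ae_of_ae_map (hasLaw_sqNorm_div hN hv).aemeasurable hgamma] with x hx h0
  simp [h0] at hx

lemma sqNorm_beamformer {x : Fin N → ℂ} (hx : sqNorm x ≠ 0) : sqNorm (beamformer x) = 1 := by
  have hbeam : beamformer x = ((√(sqNorm x))⁻¹ : ℂ) • star x := by
    ext j
    simp [beamformer, div_eq_inv_mul]
  have hstar : sqNorm (star x) = sqNorm x := by simp [sqNorm]
  rw [hbeam, sqNorm_smul, hstar, norm_inv, Complex.norm_real, Real.norm_eq_abs, inv_pow, sq_abs,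
    Real.sq_sqrt (sqNorm_nonneg x), inv_mul_cancel₀ hx]

lemma measurable_dotProduct_beamformer :
    Measurable fun p : (Fin N → ℂ) × (Fin N → ℂ) ↦ p.2 ⬝ᵥ beamformer p.1 := by
  unfold dotProduct beamformer
  fun_prop

-- Given `p.1`, the coefficient `p.2 ⬝ᵥ beamformer p.1` is a projection of `p.2` on a fixed unit
-- vector, whose law does not depend on that vector.
lemma hasLaw_dotProduct_beamformer (hN : 0 < N) (hv : v ≠ 0) :
    HasLaw (fun p ↦ p.2 ⬝ᵥ beamformer p.1) (complexGaussian w)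
      ((Measure.pi fun _ : Fin N ↦ complexGaussian v).prod
        (Measure.pi fun _ : Fin N ↦ complexGaussian w)) := by
  have hm := measurable_dotProduct_beamformer (N := N)
  refine ⟨hm.aemeasurable, ?_⟩
  ext s hs
  rw [Measure.map_apply hm hs, Measure.prod_apply (hm hs),
    lintegral_congr_ae (g := fun _ ↦ complexGaussian w s)]
  · simp
  filter_upwards [ae_sqNorm_ne_zero hN hv] with x hx
  have hproj := map_dotProduct_complexGaussian w (a := beamformer x) (w := w)
    (by rw [sqNorm_beamformer hx, mul_one])
  refine Eq.trans ?_ (DFunLike.congr_fun hproj s)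
  rw [Measure.map_apply (by unfold dotProduct; fun_prop) hs]
  rfl

end GammaLaw

section DownlinkModel

variable {N Ttr : ℕ} {P : ℝ} {σsq : ℝ≥0}

lemma pilotPower_pos (hN : 1 ≤ N) (hT : N ≤ Ttr) (hP : 0 < P) : 0 < pilotPower N Ttr P := by
  have : 0 < Ttr := hN.trans hT
  unfold pilotPower
  positivity

lemma estimateVar_pos (hΛ : 0 < pilotPower N Ttr P) : 0 < estimateVar N Ttr P σsq := by
  unfold estimateVar
  positivity

lemma errorVar_nonneg (hΛ : 0 < pilotPower N Ttr P) : 0 ≤ errorVar N Ttr P σsq := by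
  unfold errorVar
  positivity

lemma estimateVar_add_errorVar (hΛ : 0 < pilotPower N Ttr P) :
    estimateVar N Ttr P σsq + errorVar N Ttr P σsq = 1 := by
  unfold estimateVar errorVar
  field_simp

lemma effectiveSNR_pos (hP : 0 < P) (hσ : 0 < σsq) (hΛ : 0 < pilotPower N Ttr P) :
    0 < effectiveSNR N Ttr P σsq := by
  have hest := estimateVar_pos (σsq := σsq) hΛ
  have herr := errorVar_nonneg (σsq := σsq) hΛ
  unfold effectiveSNR
  positivity

variable {S : Matrix (Fin N) (Fin Ttr) ℂ}

lemma estimate_eq (hS : S * Sᴴ = 1) (hΛ : 0 < pilotPower N Ttr P) (x : Fin N → ℂ)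
    (y : Fin Ttr → ℂ) :
    estimate P σsq S x y = (estimateVar N Ttr P σsq : ℂ) • x
      + ((√(pilotPower N Ttr P) / (pilotPower N Ttr P + σsq) : ℝ) : ℂ) • (y ᵥ* Sᴴ) := by
  rw [estimate, trainingSignal, add_vecMul, smul_vecMul, vecMul_vecMul, hS, vecMul_one, smul_add,
    smul_smul, ← Complex.ofReal_mul, div_mul_eq_mul_div, Real.mul_self_sqrt hΛ.le, estimateVar]

lemma estimationError_eq (hS : S * Sᴴ = 1) (hΛ : 0 < pilotPower N Ttr P) (x : Fin N → ℂ)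
    (y : Fin Ttr → ℂ) :
    estimationError P σsq S x y = (errorVar N Ttr P σsq : ℂ) • x
      - ((√(pilotPower N Ttr P) / (pilotPower N Ttr P + σsq) : ℝ) : ℂ) • (y ᵥ* Sᴴ) := by
  rw [estimationError, estimate_eq hS hΛ, ← sub_sub, sub_left_inj,
    eq_sub_of_add_eq' (estimateVar_add_errorVar (σsq := σsq) hΛ), Complex.ofReal_sub, sub_smul,
    Complex.ofReal_one, one_smul]

@[fun_prop]
lemma measurable_estimate :
    Measurable fun p : (Fin N → ℂ) × (Fin Ttr → ℂ) ↦ estimate P σsq S p.1 p.2 := by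
  unfold estimate trainingSignal vecMul dotProduct
  fun_prop

@[fun_prop]
lemma measurable_estimationError :
    Measurable fun p : (Fin N → ℂ) × (Fin Ttr → ℂ) ↦ estimationError P σsq S p.1 p.2 :=
  measurable_fst.sub measurable_estimate

lemma measurable_estimationError_dotProduct_beamformer :
    Measurable fun p : (Fin N → ℂ) × (Fin Ttr → ℂ) ↦
      estimationError P σsq S p.1 p.2 ⬝ᵥ beamformer (estimate P σsq S p.1 p.2) :=
  measurable_dotProduct_beamformer.comp (measurable_estimate.prodMk measurable_estimationError)

lemma hasLaw_estimate_estimationError_prod (hS : S * Sᴴ = 1) (hΛ : 0 < pilotPower N Ttr P) :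
    HasLaw (fun p : (Fin N → ℂ) × (Fin Ttr → ℂ) ↦
        (estimate P σsq S p.1 p.2, estimationError P σsq S p.1 p.2))
      ((Measure.pi fun _ ↦ complexGaussian (estimateVar N Ttr P σsq).toNNReal).prod
        (Measure.pi fun _ ↦ complexGaussian (errorVar N Ttr P σsq).toNNReal))
      ((Measure.pi fun _ ↦ complexGaussian 1).prod
        (Measure.pi fun _ ↦ complexGaussian σsq)) := by
  have hκ := Real.coe_toNNReal _ (estimateVar_pos (σsq := σsq) hΛ).le
  have hη := Real.coe_toNNReal _ (errorVar_nonneg (σsq := σsq) hΛ)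
  refine ⟨by fun_prop, ?_⟩
  rw [← map_prod_complexGaussian_eq_prod hS (s := σsq)
    (c := √(pilotPower N Ttr P) / (pilotPower N Ttr P + σsq))
    (by rw [hκ, hη, estimateVar_add_errorVar hΛ])
    (by rw [hκ, hη, div_pow, Real.sq_sqrt hΛ.le, estimateVar, errorVar]; field_simp)]
  simp_rw [estimate_eq hS hΛ, estimationError_eq hS hΛ, hκ, hη]

variable {Ω : Type*} [MeasurableSpace Ω] {μ : Measure Ω} {h : Ω → Fin N → ℂ}
  {nd : Ω → Fin Ttr → ℂ} {u n : Ω → ℂ}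

namespace IsDownlinkModel

lemma memLp_u (hm : IsDownlinkModel μ σsq S h nd u n) : MemLp u 2 μ := by
  refine (memLp_two_iff_integrable_sq_norm hm.meas_u.aestronglyMeasurable).2 ?_
  exact .of_integral_ne_zero (by rw [hm.power_u]; exact one_ne_zero)

lemma indepFun_estimationError_dotProduct_beamformer (hm : IsDownlinkModel μ σsq S h nd u n) :
    IndepFun (fun ω ↦ estimationError P σsq S (h ω) (nd ω)
      ⬝ᵥ beamformer (estimate P σsq S (h ω) (nd ω))) u μ :=
  hm.indep_u.comp (measurable_estimationError_dotProduct_beamformer (P := P) (σsq := σsq) (S := S))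
    measurable_id

lemma indepFun_interference (hm : IsDownlinkModel μ σsq S h nd u n) :
    IndepFun (fun ω ↦ √P * (estimationError P σsq S (h ω) (nd ω)
      ⬝ᵥ beamformer (estimate P σsq S (h ω) (nd ω))) * u ω) n μ :=
  hm.indep_n.comp (φ := fun q : (Fin N → ℂ) × (Fin Ttr → ℂ) × ℂ ↦
      √P * (estimationError P σsq S q.1 q.2.1 ⬝ᵥ beamformer (estimate P σsq S q.1 q.2.1)) * q.2.2)
    ((measurable_const.mul (measurable_estimationError_dotProduct_beamformer.comp
      (measurable_fst.prodMk measurable_snd.fst))).mul measurable_snd.snd) measurable_id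

variable [IsProbabilityMeasure μ]

lemma hasLaw_estimate_estimationError (hm : IsDownlinkModel μ σsq S h nd u n)
    (hΛ : 0 < pilotPower N Ttr P) :
    HasLaw (fun ω ↦ (estimate P σsq S (h ω) (nd ω), estimationError P σsq S (h ω) (nd ω)))
      ((Measure.pi fun _ ↦ complexGaussian (estimateVar N Ttr P σsq).toNNReal).prod
        (Measure.pi fun _ ↦ complexGaussian (errorVar N Ttr P σsq).toNNReal)) μ := by
  have hcomp := (hasLaw_estimate_estimationError_prod hm.pilots hΛ).comp
    (hm.indep_nd.hasLaw_prod hm.law_h hm.law_nd)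
  simpa only [Function.comp_def] using hcomp

lemma hasLaw_estimate (hm : IsDownlinkModel μ σsq S h nd u n) (hΛ : 0 < pilotPower N Ttr P) :
    HasLaw (fun ω ↦ estimate P σsq S (h ω) (nd ω))
      (Measure.pi fun _ ↦ complexGaussian (estimateVar N Ttr P σsq).toNNReal) μ :=
  measurePreserving_fst.fun_comp_hasLaw (hm.hasLaw_estimate_estimationError hΛ)

lemma hasLaw_estimationError (hm : IsDownlinkModel μ σsq S h nd u n)
    (hΛ : 0 < pilotPower N Ttr P) :
    HasLaw (fun ω ↦ estimationError P σsq S (h ω) (nd ω))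
      (Measure.pi fun _ ↦ complexGaussian (errorVar N Ttr P σsq).toNNReal) μ :=
  measurePreserving_snd.fun_comp_hasLaw (hm.hasLaw_estimate_estimationError hΛ)

lemma complexVariance_estimate (hm : IsDownlinkModel μ σsq S h nd u n)
    (hΛ : 0 < pilotPower N Ttr P) (j : Fin N) :
    complexVariance (fun ω ↦ estimate P σsq S (h ω) (nd ω) j) μ = estimateVar N Ttr P σsq := by
  rw [complexVariance_of_hasLaw_complexGaussian
    ((measurePreserving_eval _ j).fun_comp_hasLaw (hm.hasLaw_estimate hΛ)),
    Real.coe_toNNReal _ (estimateVar_pos hΛ).le]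

lemma complexVariance_estimationError (hm : IsDownlinkModel μ σsq S h nd u n)
    (hΛ : 0 < pilotPower N Ttr P) (j : Fin N) :
    complexVariance (fun ω ↦ estimationError P σsq S (h ω) (nd ω) j) μ
      = errorVar N Ttr P σsq := by
  rw [complexVariance_of_hasLaw_complexGaussian
    ((measurePreserving_eval _ j).fun_comp_hasLaw (hm.hasLaw_estimationError hΛ)),
    Real.coe_toNNReal _ (errorVar_nonneg hΛ)]

lemma hasLaw_estimationError_dotProduct_beamformer (hm : IsDownlinkModel μ σsq S h nd u n)
    (hN : 1 ≤ N) (hΛ : 0 < pilotPower N Ttr P) :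
    HasLaw (fun ω ↦ estimationError P σsq S (h ω) (nd ω)
        ⬝ᵥ beamformer (estimate P σsq S (h ω) (nd ω)))
      (complexGaussian (errorVar N Ttr P σsq).toNNReal) μ := by
  have hκ := (Real.toNNReal_pos.2 (estimateVar_pos (σsq := σsq) hΛ)).ne'
  have hcomp := (hasLaw_dotProduct_beamformer hN hκ).comp (hm.hasLaw_estimate_estimationError hΛ)
  simpa only [Function.comp_def] using hcomp

lemma complexVariance_effectiveNoise (hm : IsDownlinkModel μ σsq S h nd u n) (hN : 1 ≤ N)
    (hP : 0 ≤ P) (hΛ : 0 < pilotPower N Ttr P) :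
    complexVariance (fun ω ↦ effectiveNoise P σsq S (h ω) (nd ω) (u ω) (n ω)) μ
      = P * errorVar N Ttr P σsq + σsq := by
  have hlaw := hm.hasLaw_estimationError_dotProduct_beamformer hN hΛ
  have hgL2 := memLp_two_of_hasLaw_complexGaussian hlaw
  have hgu := hm.indepFun_estimationError_dotProduct_beamformer (P := P)
  have hscaled := ((memLp_two_mul_of_indepFun hgL2 hm.memLp_u hgu).const_mul (√P : ℂ))
  simp only [← mul_assoc] at hscaled
  unfold effectiveNoise
  rw [complexVariance_add hscaled (memLp_two_of_hasLaw_complexGaussian hm.law_n)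
    hm.indepFun_interference]
  simp only [mul_assoc]
  rw [complexVariance_const_mul,
    complexVariance_mul_of_indepFun hgL2.1 hm.memLp_u.1 hgu
      (integral_of_hasLaw_complexGaussian hlaw),
    complexVariance_of_hasLaw_complexGaussian hlaw, hm.power_u,
    complexVariance_of_hasLaw_complexGaussian hm.law_n, Real.coe_toNNReal _ (errorVar_nonneg hΛ),
    Complex.norm_real, Real.norm_eq_abs, sq_abs, Real.sq_sqrt hP, mul_one]

lemma exists_hasLaw_gammaMeasure_sinr_eq (hm : IsDownlinkModel μ σsq S h nd u n) (hN : 1 ≤ N)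
    (hP : 0 ≤ P) (hσ : 0 < σsq) (hΛ : 0 < pilotPower N Ttr P) :
    ∃ X : Ω → ℝ, HasLaw X (gammaMeasure N 1) μ ∧
      ∀ ω, sinr μ P σsq S h nd u n ω = effectiveSNR N Ttr P σsq * X ω := by
  have hest := estimateVar_pos (σsq := σsq) hΛ
  have herr := errorVar_nonneg (σsq := σsq) hΛ
  refine ⟨fun ω ↦ sqNorm (estimate P σsq S (h ω) (nd ω)) / (estimateVar N Ttr P σsq).toNNReal,
    (hasLaw_sqNorm_div hN (Real.toNNReal_pos.2 hest).ne').fun_comp (hm.hasLaw_estimate hΛ),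
    fun ω ↦ ?_⟩
  rw [sinr, hm.complexVariance_effectiveNoise hN hP hΛ, effectiveSNR, Real.coe_toNNReal _ hest.le]
  field_simp

end IsDownlinkModel

end DownlinkModel

section LaplaceMellin

variable {E : Type*} [NormedAddCommGroup E] {f : ℝ → E} {w s : ℂ} {z b : ℝ}

/-- The Laplace transform `z ↦ ∫₀^∞ e^{-zy} f(y) dy` on the real line; Meijer's `G` of the theorem
is the Laplace transform of a function whose Mellin transform is elementary. -/
def laplaceTransform [NormedSpace ℝ E] (f : ℝ → E) (z : ℝ) : E :=
  ∫ y in Set.Ioi (0 : ℝ), Real.exp (-(z * y)) • f y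

lemma laplaceTransform_ofReal (f : ℝ → ℝ) (z : ℝ) :
    laplaceTransform (fun y ↦ (f y : ℂ)) z = (laplaceTransform f z : ℝ) := by
  simp only [laplaceTransform, Complex.real_smul, smul_eq_mul, ← Complex.ofReal_mul,
    integral_complex_ofReal]

lemma continuousAt_laplaceTransform [NormedSpace ℝ E] (hb : b < z)
    (hf : IntegrableOn (fun y ↦ Real.exp (-(b * y)) • f y) (Set.Ioi 0)) :
    ContinuousAt (laplaceTransform f) z := by
  have hshift (x : ℝ) : (fun y ↦ Real.exp (-(x * y)) • f y)
      = fun y ↦ Real.exp (-((x - b) * y)) • Real.exp (-(b * y)) • f y := by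
    ext y
    rw [smul_smul, ← Real.exp_add]
    ring_nf
  refine continuousAt_of_dominated (.of_forall fun x ↦ ?_) ?_ hf.norm
    (ae_of_all _ fun y ↦ Continuous.continuousAt (by fun_prop))
  · rw [hshift]
    exact AEStronglyMeasurable.smul (by fun_prop) hf.aestronglyMeasurable
  · filter_upwards [lt_mem_nhds hb] with x hx
    filter_upwards [ae_restrict_mem measurableSet_Ioi] with y (hy : 0 < y)
    rw [norm_smul, norm_smul]
    simp only [Real.norm_eq_abs, Real.abs_exp]
    gcongr

lemma integrableOn_rpow_mul_exp_neg_mul {a r : ℝ} (ha : 0 < a) (hr : 0 < r) :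
    IntegrableOn (fun t : ℝ ↦ t ^ (a - 1) * Real.exp (-(r * t))) (Set.Ioi 0) := by
  simpa only [Real.rpow_one, neg_mul] using
    integrableOn_rpow_mul_exp_neg_mul_rpow (s := a - 1) (p := 1) (by linarith) one_pos hr

variable [NormedSpace ℂ E]

lemma aestronglyMeasurable_of_mellinConvergent (hf : MellinConvergent f s) :
    AEStronglyMeasurable f (volume.restrict (Set.Ioi 0)) := by
  have hmul : AEStronglyMeasurable (fun t : ℝ ↦ (t : ℂ) ^ (1 - s) • (t : ℂ) ^ (s - 1) • f t)
      (volume.restrict (Set.Ioi 0)) :=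
    AEStronglyMeasurable.smul (Measurable.aestronglyMeasurable (by fun_prop))
      (Integrable.aestronglyMeasurable hf)
  refine hmul.congr ?_
  filter_upwards [ae_restrict_mem measurableSet_Ioi] with t (ht : 0 < t)
  rw [smul_smul, ← Complex.cpow_add _ _ (by exact_mod_cast ht.ne')]
  simp

lemma norm_mellin_laplace_kernel {t y : ℝ} (ht : 0 < t) (x : E) :
    ‖(t : ℂ) ^ (w - 1) • Real.exp (-(t * y)) • x‖
      = t ^ (w.re - 1) * Real.exp (-(y * t)) * ‖x‖ := by
  rw [norm_smul, norm_smul, Complex.norm_cpow_eq_rpow_re_of_pos ht, Real.norm_eq_abs,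
    Real.abs_exp, mul_comm t, mul_assoc]
  simp

lemma integrable_mellin_laplace_kernel (hw : 0 < w.re) (hf : MellinConvergent f (1 - w)) :
    Integrable (Function.uncurry fun t y : ℝ ↦ (t : ℂ) ^ (w - 1) • Real.exp (-(t * y)) • f y)
      ((volume.restrict (Set.Ioi 0)).prod (volume.restrict (Set.Ioi 0))) := by
  have hmeas : AEStronglyMeasurable
      (Function.uncurry fun t y : ℝ ↦ (t : ℂ) ^ (w - 1) • Real.exp (-(t * y)) • f y)
      ((volume.restrict (Set.Ioi 0)).prod (volume.restrict (Set.Ioi 0))) := by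
    simp only [Function.uncurry_def]
    exact .smul (Measurable.aestronglyMeasurable (by fun_prop)) <|
      .smul (f := fun p : ℝ × ℝ ↦ Real.exp (-(p.1 * p.2))) (by fun_prop)
        (aestronglyMeasurable_of_mellinConvergent hf).comp_snd
  refine (integrable_prod_iff' hmeas).2 ⟨?_, ?_⟩
  · filter_upwards [ae_restrict_mem measurableSet_Ioi] with y (hy : 0 < y)
    refine ((integrableOn_rpow_mul_exp_neg_mul hw hy).mul_const ‖f y‖).mono' ?_ ?_
    · exact .smul (Measurable.aestronglyMeasurable (by fun_prop))
        (.smul (f := fun t : ℝ ↦ Real.exp (-(t * y))) (by fun_prop)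
          (aestronglyMeasurable_const (b := f y)))
    · filter_upwards [ae_restrict_mem measurableSet_Ioi] with t ht
      exact (norm_mellin_laplace_kernel ht _).le
  · refine (hf.norm.const_mul (Real.Gamma w.re)).congr ?_
    filter_upwards [ae_restrict_mem measurableSet_Ioi] with y (hy : 0 < y)
    simp only [Function.uncurry_apply_pair]
    rw [setIntegral_congr_fun measurableSet_Ioi fun t ht ↦ norm_mellin_laplace_kernel ht _,
      integral_mul_const, Real.integral_rpow_mul_exp_neg_mul_Ioi hw hy, norm_smul,
      Complex.norm_cpow_eq_rpow_re_of_pos hy, one_div, Real.inv_rpow hy.le,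
      show (1 - w - 1).re = -w.re by simp, Real.rpow_neg hy.le]
    ring

lemma hasMellin_laplaceTransform [CompleteSpace E] (hw : 0 < w.re)
    (hf : MellinConvergent f (1 - w)) :
    HasMellin (laplaceTransform f) w (Complex.Gamma w • mellin f (1 - w)) := by
  have hker := integrable_mellin_laplace_kernel hw hf
  have hswap (t : ℝ) : (t : ℂ) ^ (w - 1) • laplaceTransform f t
      = ∫ y in Set.Ioi (0 : ℝ), (t : ℂ) ^ (w - 1) • Real.exp (-(t * y)) • f y := by
    rw [laplaceTransform, integral_smul]
  refine ⟨hker.integral_prod_left.congr (ae_of_all _ fun t ↦ (hswap t).symm), ?_⟩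
  simp only [mellin, hswap]
  rw [integral_integral_swap hker, ← integral_smul]
  refine setIntegral_congr_fun measurableSet_Ioi fun y (hy : 0 < y) ↦ ?_
  have hcpow : (1 / (y : ℂ)) ^ w = (y : ℂ) ^ (1 - w - 1) := by
    have harg : (y : ℂ).arg ≠ Real.pi := by
      rw [Complex.arg_ofReal_of_nonneg hy.le]
      exact Real.pi_ne_zero.symm
    rw [one_div, Complex.inv_cpow _ _ harg, ← Complex.cpow_neg, sub_sub_cancel_left]
  calc ∫ t in Set.Ioi (0 : ℝ), (t : ℂ) ^ (w - 1) • Real.exp (-(t * y)) • f y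
      = ∫ t in Set.Ioi (0 : ℝ), ((t : ℂ) ^ (w - 1) * Complex.exp (-(y * t))) • f y := by
        congr with t
        rw [mul_smul, ← Complex.coe_smul (Real.exp _)]
        push_cast
        rw [mul_comm (t : ℂ)]
    _ = Complex.Gamma w • (y : ℂ) ^ (1 - w - 1) • f y := by
        rw [integral_smul_const, Complex.integral_cpow_mul_exp_neg_mul_Ioi hw hy, hcpow, smul_smul,
          mul_comm]

end LaplaceMellin

section PowLog

variable {n : ℕ} {s : ℂ}

lemma hasMellin_log_Ioc (hs : 0 < s.re) :
    HasMellin ((Set.Ioc 0 1).indicator fun t : ℝ ↦ (Real.log t : ℂ)) s (-(s ^ 2)⁻¹) := by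
  let step := (Set.Ioc 0 1).indicator fun _ : ℝ ↦ (1 : ℂ)
  have hlog : (Set.Ioc 0 1).indicator (fun t : ℝ ↦ (Real.log t : ℂ))
      = fun t ↦ Real.log t • step t := by
    ext t
    by_cases ht : t ∈ Set.Ioc (0 : ℝ) 1 <;> simp [step, ht]
  have hloc : LocallyIntegrableOn step (Set.Ioi 0) :=
    ((locallyIntegrable_const 1).indicator measurableSet_Ioc).locallyIntegrableOn _
  have htop : step =O[Filter.atTop] fun t : ℝ ↦ t ^ (-(s.re + 1)) := by
    refine (Asymptotics.isBigO_zero _ _).congr' ?_ .rfl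
    filter_upwards [Filter.eventually_gt_atTop 1] with t ht
    simp [step, ht]
  have hbot : step =O[nhdsWithin 0 (Set.Ioi 0)] fun t : ℝ ↦ t ^ (-0 : ℝ) := by
    refine Asymptotics.isBigO_of_le _ fun t ↦ ?_
    by_cases ht : t ∈ Set.Ioc (0 : ℝ) 1 <;> simp [step, ht]
  obtain ⟨hconv, hderiv⟩ :=
    mellin_hasDerivAt_of_isBigO_rpow hloc htop (lt_add_one _) hbot hs
  rw [hlog]
  refine ⟨hconv, hderiv.unique ?_⟩
  have hs0 : s ≠ 0 := by rintro rfl; simp at hs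
  refine (hasDerivAt_inv hs0).congr_of_eventuallyEq ?_
  filter_upwards [(isOpen_lt continuous_const Complex.continuous_re).mem_nhds hs] with s' hs'
  rw [(hasMellin_one_Ioc hs').2, one_div]

/-- The function `yⁿ log y` on `(1, ∞)`, extended by `0`: after the substitution `y = 1 + γ x` the
capacity integral is a combination of Laplace transforms of these functions. -/
def powLog (n : ℕ) : ℝ → ℝ := (Set.Ioi 1).indicator fun y ↦ y ^ n * Real.log y

lemma hasMellin_powLog (hs : s.re < -n) :
    HasMellin (fun y ↦ (powLog n y : ℂ)) s ((s + n) ^ 2)⁻¹ := by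
  let logIoc := (Set.Ioc 0 1).indicator fun t : ℝ ↦ (Real.log t : ℂ)
  have hlog : HasMellin logIoc (-(s + n)) (-((s + n) ^ 2)⁻¹) := by
    have := hasMellin_log_Ioc (s := -(s + n)) (by simp; linarith)
    rwa [neg_sq] at this
  have hinv : HasMellin (fun y ↦ logIoc y⁻¹) (s + n) (-((s + n) ^ 2)⁻¹) := by
    refine ⟨?_, (mellin_comp_inv _ _).trans hlog.2⟩
    have hconv := (MellinConvergent.comp_rpow (f := logIoc) (s := s + n) (a := -1) (by simp)).2
      (by simpa only [Complex.ofReal_neg, Complex.ofReal_one, div_neg, div_one] using hlog.1)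
    simpa only [Real.rpow_neg_one] using hconv
  have hpow : Set.EqOn (fun y ↦ (powLog n y : ℂ)) (fun y ↦ -((y : ℂ) ^ (n : ℂ) • logIoc y⁻¹))
      (Set.Ioi 0) := by
    intro y (hy : 0 < y)
    rcases lt_trichotomy y 1 with hy1 | rfl | hy1
    · simp [powLog, logIoc, hy1.le, ((one_lt_inv₀ hy).2 hy1).not_ge]
    · simp [powLog, logIoc]
    · simp [powLog, logIoc, hy1, hy, inv_le_one_of_one_le₀ hy1.le]
  have hconv := hasMellin_const_smul (MellinConvergent.cpow_smul.2 hinv.1) (-1 : ℂ)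
  rw [mellin_cpow_smul, hinv.2, neg_one_smul, neg_neg] at hconv
  have hcongr : Set.EqOn (fun y : ℝ ↦ (y : ℂ) ^ (s - 1) • (-1 : ℂ) • (y : ℂ) ^ (n : ℂ) • logIoc y⁻¹)
      (fun y : ℝ ↦ (y : ℂ) ^ (s - 1) • (powLog n y : ℂ)) (Set.Ioi 0) := fun y hy ↦ by
    simp only [neg_one_smul, hpow hy]
  exact ⟨hconv.1.congr_fun hcongr measurableSet_Ioi,
    (setIntegral_congr_fun measurableSet_Ioi hcongr).symm.trans hconv.2⟩

end PowLog

section MeijerG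

variable {n : ℕ} {w s : ℂ} {z σ a : ℝ}

lemma norm_Gamma_le_Gamma_re (hw : 0 < w.re) : ‖Complex.Gamma w‖ ≤ Real.Gamma w.re := by
  rw [Complex.Gamma_eq_integral hw, Complex.GammaIntegral, Real.Gamma_eq_integral hw]
  refine (norm_integral_le_integral_norm _).trans_eq ?_
  refine setIntegral_congr_fun measurableSet_Ioi fun x (hx : 0 < x) ↦ ?_
  rw [norm_mul, Complex.norm_cpow_eq_rpow_re_of_pos hx, Complex.norm_real, Real.norm_eq_abs,
    Real.abs_exp, Complex.sub_re, Complex.one_re]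

lemma continuous_Gamma_verticalLine (hσ : 0 < σ) :
    Continuous fun t : ℝ ↦ Complex.Gamma (σ + t * Complex.I) := by
  refine continuous_iff_continuousAt.2 fun t ↦ ?_
  refine ContinuousAt.comp (f := fun t : ℝ ↦ (σ + t * Complex.I : ℂ))
    (Complex.differentiableAt_Gamma _ fun m hm ↦ ?_).continuousAt (by fun_prop)
  have hre : σ = -m := by simpa using congrArg Complex.re hm
  linarith [m.cast_nonneg (α := ℝ)]

lemma integrable_inv_sq_add_mul_I (ha : a ≠ 0) :
    Integrable fun t : ℝ ↦ ((a + t * Complex.I) ^ 2)⁻¹ := by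
  refine (integrable_inv_one_add_sq.const_mul (1 + (a ^ 2)⁻¹)).mono'
    (Measurable.aestronglyMeasurable (by fun_prop)) (ae_of_all _ fun t ↦ ?_)
  have hnorm : ‖(a + t * Complex.I : ℂ)‖ ^ 2 = a ^ 2 + t ^ 2 := by
    rw [Complex.sq_norm, Complex.normSq_add_mul_I]
  rw [norm_inv, norm_pow, hnorm, ← div_eq_mul_inv, inv_le_comm₀ (by positivity) (by positivity),
    inv_div, div_le_iff₀ (by positivity)]
  have hcross : 0 ≤ t ^ 2 * (a ^ 2)⁻¹ := by positivity
  have hsq : a ^ 2 * (a ^ 2)⁻¹ = 1 := mul_inv_cancel₀ (by positivity)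
  linarith [sq_nonneg a]

lemma verticalIntegrable_Gamma_mul_inv_sq (hσ : 0 < σ) (ha : σ ≠ a) :
    Complex.VerticalIntegrable (fun w ↦ Complex.Gamma w * ((w - a) ^ 2)⁻¹) σ := by
  refine Integrable.bdd_mul (c := Real.Gamma σ) ?_
    (continuous_Gamma_verticalLine hσ).aestronglyMeasurable (ae_of_all _ fun t ↦ ?_)
  · simpa [add_sub_right_comm] using integrable_inv_sq_add_mul_I (sub_ne_zero.2 ha)
  · simpa using norm_Gamma_le_Gamma_re (w := σ + t * Complex.I) (by simpa using hσ)

-- On a separating line the Mellin–Barnes integral is the inverse Mellin transform of `f`.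
lemma meijerG_eq_of_mellin {p q m k : ℕ} {α : Fin p → ℂ} {β : Fin q → ℂ} {f : ℝ → ℂ} (hz : 0 < z)
    (hf : ContinuousAt f z) (hline : ∃ c, IsSeparatingLine m k α β c)
    (hconv : ∀ c, IsSeparatingLine m k α β c → MellinConvergent f (-c : ℝ))
    (hint : ∀ c, IsSeparatingLine m k α β c → Complex.VerticalIntegrable (mellin f) (-c))
    (heq : ∀ s : ℂ, IsSeparatingLine m k α β s.re →
      meijerGIntegrand m k α β z s = z ^ s * mellin f (-s)) :
    meijerG m k α β z = f z := by
  rw [meijerG, dif_pos hline]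
  have hc := hline.choose_spec
  generalize hline.choose = c at hc
  rw [← mellinInv_mellin_eq (-c) f hz (hconv c hc) (hint c hc) hf, mellinInv,
    ← integral_neg_eq_self, Complex.real_smul]
  push_cast
  congr with t
  have hneg : -(c + -t * Complex.I : ℂ) = -c + t * Complex.I := by ring
  rw [heq _ (by simpa using hc), smul_eq_mul, hneg, neg_add, neg_neg, neg_mul]

lemma isSeparatingLine_three_zero_iff {c : ℝ} :
    IsSeparatingLine 3 0 ![-(n : ℂ), -(n : ℂ)] ![0, -1 - (n : ℂ), -1 - (n : ℂ)] c
      ↔ c < -1 - n := by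
  refine ⟨fun h ↦ by simpa using h.1 1 (by decide),
    fun h ↦ ⟨fun j _ ↦ ?_, fun k hk ↦ absurd hk (Nat.not_lt_zero _)⟩⟩
  fin_cases j <;> simp <;> linarith

lemma meijerGIntegrand_three_zero (hs : s.re < -1 - n) :
    meijerGIntegrand 3 0 ![-(n : ℂ), -(n : ℂ)] ![0, -1 - (n : ℂ), -1 - (n : ℂ)] (z : ℂ) s
      = (z : ℂ) ^ s * (Complex.Gamma (-s) * ((-s - (n + 1)) ^ 2)⁻¹) := by
  have hre : 0 < (-1 - n - s : ℂ).re := by simpa using hs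
  have hne : (-1 - n - s : ℂ) ≠ 0 := fun h ↦ by simp [h] at hre
  have hrec : Complex.Gamma (-n - s) = (-1 - n - s) * Complex.Gamma (-1 - n - s) := by
    rw [← Complex.Gamma_add_one _ hne]
    ring_nf
  have hGamma := Complex.Gamma_ne_zero_of_re_pos hre
  have hprod : meijerGIntegrand 3 0 ![-(n : ℂ), -(n : ℂ)] ![0, -1 - (n : ℂ), -1 - (n : ℂ)]
      (z : ℂ) s = Complex.Gamma (-s) * Complex.Gamma (-1 - n - s) ^ 2
        / Complex.Gamma (-n - s) ^ 2 * (z : ℂ) ^ s := by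
    simp [meijerGIntegrand, Finset.prod_filter, Fin.prod_univ_succ, sq]
  rw [hprod, hrec, show -s - (n + 1) = -1 - n - s by ring]
  field_simp

lemma hasMellin_laplaceTransform_powLog (hw : n + 1 < w.re) :
    HasMellin (laplaceTransform fun y ↦ (powLog n y : ℂ)) w
      (Complex.Gamma w * ((w - (n + 1)) ^ 2)⁻¹) := by
  have hpowLog : HasMellin (fun y ↦ (powLog n y : ℂ)) (1 - w) ((1 - w + n) ^ 2)⁻¹ :=
    hasMellin_powLog (by simp; linarith)
  have hw0 : 0 < w.re := lt_trans (by positivity) hw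
  have hlaplace := hasMellin_laplaceTransform hw0 hpowLog.1
  rwa [hpowLog.2, smul_eq_mul, show (1 - w + n) ^ 2 = (w - (n + 1)) ^ 2 by ring] at hlaplace

lemma measurable_powLog : Measurable (powLog n) :=
  Measurable.indicator (by fun_prop) measurableSet_Ioi

lemma integrableOn_exp_mul_powLog (n : ℕ) (hz : 0 < z) :
    IntegrableOn (fun y ↦ Real.exp (-(z * y)) * powLog n y) (Set.Ioi 0) := by
  have hbound := integrableOn_rpow_mul_exp_neg_mul (a := n + 2) (by positivity) hz
  refine hbound.mono' (Measurable.aestronglyMeasurable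
    ((by fun_prop : Measurable fun y ↦ Real.exp (-(z * y))).mul measurable_powLog)) ?_
  filter_upwards [ae_restrict_mem measurableSet_Ioi] with y (hy : 0 < y)
  rw [norm_mul, Real.norm_eq_abs, Real.abs_exp, mul_comm]
  gcongr
  rw [show (n : ℝ) + 2 - 1 = (n + 1 : ℕ) by push_cast; ring, Real.rpow_natCast, pow_succ]
  by_cases hy1 : y ∈ Set.Ioi 1
  · have hlog : 0 ≤ Real.log y := Real.log_nonneg (Set.mem_Ioi.1 hy1).le
    rw [powLog, Set.indicator_of_mem hy1, Real.norm_of_nonneg (by positivity)]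
    gcongr
    exact Real.log_le_self hy.le
  · rw [powLog, Set.indicator_of_notMem hy1, norm_zero]
    positivity

lemma meijerG_eq_laplaceTransform_powLog (n : ℕ) (hz : 0 < z) :
    meijerG 3 0 ![-(n : ℂ), -(n : ℂ)] ![0, -1 - (n : ℂ), -1 - (n : ℂ)] (z : ℂ)
      = (laplaceTransform (powLog n) z : ℝ) := by
  rw [← laplaceTransform_ofReal]
  refine meijerG_eq_of_mellin hz ?_ ⟨-2 - n, ?_⟩ (fun c hc ↦ ?_) (fun c hc ↦ ?_) (fun s hs ↦ ?_)
  · refine continuousAt_laplaceTransform (half_lt_self hz) ?_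
    simp only [Complex.real_smul, ← Complex.ofReal_mul]
    exact Integrable.ofReal (integrableOn_exp_mul_powLog n (half_pos hz))
  · rw [isSeparatingLine_three_zero_iff]
    linarith
  · rw [isSeparatingLine_three_zero_iff] at hc
    exact (hasMellin_laplaceTransform_powLog (by simp; linarith)).1
  · rw [isSeparatingLine_three_zero_iff] at hc
    have hGamma :=
      verticalIntegrable_Gamma_mul_inv_sq (σ := -c) (a := n + 1) (by linarith) (by linarith)
    refine hGamma.congr (ae_of_all _ fun t ↦ ?_)
    have hmellin := hasMellin_laplaceTransform_powLog (n := n) (w := (-c : ℝ) + t * Complex.I)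
      (by simp; linarith)
    simp only [hmellin.2]
    push_cast
    rfl
  · rw [isSeparatingLine_three_zero_iff] at hs
    rw [meijerGIntegrand_three_zero hs,
      (hasMellin_laplaceTransform_powLog (by simp; linarith)).2]

end MeijerG

section CapacityTerm

variable {Ω : Type*} [MeasurableSpace Ω] {μ : Measure Ω} {X : Ω → ℝ} {N : ℕ} {γ z : ℝ}

lemma laplaceTransform_powLog (n : ℕ) (z : ℝ) :
    laplaceTransform (powLog n) z
      = ∫ y in Set.Ioi (1 : ℝ), Real.exp (-(z * y)) * (y ^ n * Real.log y) := by
  have hind : (fun y ↦ Real.exp (-(z * y)) • powLog n y) = (Set.Ioi 1).indicator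
      fun y ↦ Real.exp (-(z * y)) * (y ^ n * Real.log y) := by
    ext y
    by_cases hy : 1 < y <;> simp [powLog, hy]
  rw [laplaceTransform, hind, setIntegral_indicator measurableSet_Ioi,
    Set.inter_eq_right.2 (Set.Ioi_subset_Ioi zero_le_one)]

lemma integrableOn_exp_mul_pow_mul_log (n : ℕ) (hz : 0 < z) :
    IntegrableOn (fun y : ℝ ↦ Real.exp (-(z * y)) * (y ^ n * Real.log y)) (Set.Ioi 1) :=
  ((integrableOn_exp_mul_powLog n hz).mono_set (Set.Ioi_subset_Ioi zero_le_one)).congr_fun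
    (fun y hy ↦ by simp only [powLog, Set.indicator_of_mem hy]) measurableSet_Ioi

lemma setIntegral_exp_mul_sub_one_pow_mul_log (m : ℕ) (hz : 0 < z) :
    ∫ y in Set.Ioi (1 : ℝ), Real.exp (-(z * y)) * ((y - 1) ^ m * Real.log y)
      = ∑ i ∈ Finset.range (m + 1),
          (m.choose i : ℝ) * (-1) ^ (m - i) * laplaceTransform (powLog i) z := by
  simp_rw [laplaceTransform_powLog, ← integral_const_mul]
  rw [← integral_finsetSum _ fun i _ ↦ (integrableOn_exp_mul_pow_mul_log i hz).const_mul _]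
  congr with y
  simp only [sub_eq_add_neg y, add_pow, Finset.sum_mul, Finset.mul_sum]
  exact Finset.sum_congr rfl fun i _ ↦ by ring

lemma setIntegral_Ioi_comp_one_add_mul (hγ : 0 < γ) (g : ℝ → ℝ) :
    ∫ x in Set.Ioi (0 : ℝ), g (1 + γ * x) = γ⁻¹ * ∫ y in Set.Ioi (1 : ℝ), g y := by
  have hscale := integral_comp_mul_left_Ioi (fun t ↦ g (1 + t)) 0 hγ
  rw [hscale, mul_zero, smul_eq_mul, ← integral_indicator measurableSet_Ioi,
    ← integral_indicator measurableSet_Ioi,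
    ← integral_add_left_eq_self (Set.indicator (Set.Ioi 1) g) (1 : ℝ)]
  simp [Set.indicator_apply]

-- Substitute `y = 1 + γ x` and expand `xᵐ = γ⁻ᵐ (y - 1)ᵐ`.
lemma integral_capacity_gammaMeasure_eq_sum (m : ℕ) (hγ : 0 < γ) :
    ∫ x, capacity (γ * x) ∂gammaMeasure (m + 1 : ℕ) 1
      = Real.exp (1 / γ) / (Real.log 2 * Real.Gamma (m + 1 : ℕ) * γ ^ (m + 1)) *
        ∑ i ∈ Finset.range (m + 1),
          (m.choose i : ℝ) * (-1) ^ (m - i) * laplaceTransform (powLog i) (1 / γ) := by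
  let g (y : ℝ) := Real.exp (-(1 / γ * y)) * ((y - 1) ^ m * Real.log y)
  let c := Real.exp (1 / γ) / (Real.log 2 * Real.Gamma (m + 1 : ℕ) * γ ^ m)
  have hintegrand (x : ℝ) : (1 ^ ((m + 1 : ℕ) : ℝ) / Real.Gamma (m + 1 : ℕ) *
      x ^ (((m + 1 : ℕ) : ℝ) - 1) * Real.exp (-(1 * x))) • capacity (γ * x)
        = c * g (1 + γ * x) := by
    have hexp : Real.exp (-(1 / γ * (1 + γ * x))) = Real.exp (-x) / Real.exp (1 / γ) := by
      rw [← Real.exp_sub]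
      congr 1
      field_simp
      ring
    have hpow : x ^ (((m + 1 : ℕ) : ℝ) - 1) = x ^ m := by simp
    simp only [c, g, hexp, hpow, capacity, Real.logb, Real.one_rpow, one_mul, smul_eq_mul,
      add_sub_cancel_left, mul_pow]
    field_simp
  rw [integral_gammaMeasure (by positivity) one_pos]
  simp_rw [hintegrand]
  rw [integral_const_mul, setIntegral_Ioi_comp_one_add_mul hγ,
    setIntegral_exp_mul_sub_one_pow_mul_log m (by positivity), pow_succ]
  simp only [c]
  field_simp

lemma integral_capacity_gammaMeasure (hN : 1 ≤ N) (hγ : 0 < γ) :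
    ((∫ x, capacity (γ * x) ∂gammaMeasure N 1 : ℝ) : ℂ) = Phi γ N := by
  obtain ⟨m, rfl⟩ := Nat.exists_eq_add_of_le' hN
  rw [integral_capacity_gammaMeasure_eq_sum m hγ, Phi]
  simp only [Nat.add_sub_cancel, meijerG_eq_laplaceTransform_powLog _ (one_div_pos.2 hγ)]
  push_cast
  rfl

lemma measurable_capacity : Measurable capacity := by
  unfold capacity Real.logb
  fun_prop

lemma capacity_nonneg (hγ : 0 ≤ γ) : 0 ≤ capacity γ :=
  Real.logb_nonneg one_lt_two (by linarith)

lemma capacity_le_div_log (hγ : 0 ≤ γ) : capacity γ ≤ γ / Real.log 2 := by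
  rw [capacity, Real.logb]
  have := Real.log_pos one_lt_two
  gcongr
  linarith [Real.log_le_sub_one_of_pos (show 0 < 1 + γ by linarith)]

lemma integrable_capacity (hX : Integrable X μ) (h0 : 0 ≤ᵐ[μ] X) :
    Integrable (fun ω ↦ capacity (X ω)) μ := by
  refine (hX.div_const (Real.log 2)).mono'
    (measurable_capacity.comp_aemeasurable hX.aemeasurable).aestronglyMeasurable ?_
  filter_upwards [h0] with ω hω
  rw [Real.norm_of_nonneg (capacity_nonneg hω)]
  exact capacity_le_div_log hω

lemma integrable_capacity_of_hasLaw (hX : HasLaw X (gammaMeasure N 1) μ) (hN : 1 ≤ N)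
    (hγ : 0 ≤ γ) : Integrable (fun ω ↦ capacity (γ * X ω)) μ := by
  have h0 := (hX.ae_iff measurableSet_Ici.mem).2 (ae_nonneg_gammaMeasure N 1)
  refine integrable_capacity
    ((integrable_of_hasLaw_gammaMeasure hX (by exact_mod_cast hN)).const_mul γ) ?_
  filter_upwards [h0] with ω hω using mul_nonneg hγ hω

lemma integral_capacity_of_hasLaw (hX : HasLaw X (gammaMeasure N 1) μ) (hN : 1 ≤ N)
    (hγ : 0 < γ) : ((∫ ω, capacity (γ * X ω) ∂μ : ℝ) : ℂ) = Phi γ N := by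
  rw [← integral_capacity_gammaMeasure hN hγ]
  exact congrArg _
    (hX.integral_comp (measurable_capacity.comp (measurable_const_mul γ)).aestronglyMeasurable)

end CapacityTerm

section DispersionTerm

variable {Ω : Type*} [MeasurableSpace Ω] {μ : Measure Ω} {X : Ω → ℝ} {a r t x γ : ℝ}

/-- The channel dispersion in squared nats, i.e. `dispersion` without the factor `(log₂ e)²` that
converts nats to bits. -/
def dispersionNats (x : ℝ) : ℝ := 1 - ((1 + x) ^ 2)⁻¹

lemma dispersion_eq (x : ℝ) : dispersion x = (1 / Real.log 2) ^ 2 * dispersionNats x := by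
  rw [dispersion, dispersionNats, Real.logb, Real.log_exp]

lemma measurable_dispersionNats : Measurable dispersionNats := by
  unfold dispersionNats
  fun_prop

lemma dispersionNats_le_one (x : ℝ) : dispersionNats x ≤ 1 :=
  sub_le_self _ (by positivity)

lemma dispersionNats_nonneg (hx : 0 ≤ x) : 0 ≤ dispersionNats x :=
  sub_nonneg.2 (inv_le_one_of_one_le₀ (one_le_pow₀ (by linarith)))

lemma dispersionNats_pos (hx : 0 < x) : 0 < dispersionNats x :=
  sub_pos.2 (inv_lt_one_of_one_lt₀ (one_lt_pow₀ (by linarith) two_ne_zero))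

lemma dispersionNats_mul_div (ht : 0 < t) (hr : 0 ≤ r) :
    dispersionNats (t * r) / dispersionNats t
      = 1 + (r - 1) * ((2 + t + t * r) / ((1 + t * r) ^ 2 * (2 + t))) := by
  have hd : dispersionNats t = t * (2 + t) / (1 + t) ^ 2 := by
    rw [dispersionNats]
    field_simp
    ring
  rw [hd, dispersionNats]
  field_simp
  ring

lemma dispersionNats_mul_div_sub_one_sq_le (ht : 0 < t) (hr : 0 ≤ r) :
    (dispersionNats (t * r) / dispersionNats t - 1) ^ 2 ≤ (r - 1) ^ 2 := by
  have htr : 0 ≤ t * r := by positivity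
  have hle : (2 + t + t * r) / ((1 + t * r) ^ 2 * (2 + t)) ≤ 1 := by
    rw [div_le_one (by positivity)]
    nlinarith [mul_nonneg htr ht.le, mul_nonneg htr htr, mul_nonneg (mul_nonneg htr htr) ht.le]
  rw [dispersionNats_mul_div ht hr, add_sub_cancel_left, mul_pow]
  exact mul_le_of_le_one_right (sq_nonneg _) (pow_le_one₀ (by positivity) hle)

lemma tangent_sub_dispersionNats_mul_div (ht : 0 < t) (hr : 0 ≤ r) :
    1 + 2 / ((1 + t) * (2 + t)) * (r - 1) - dispersionNats (t * r) / dispersionNats t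
      = (r - 1) ^ 2 *
          (t * (1 + t + 2 * (1 + t * r)) / ((1 + t) * (1 + t * r) ^ 2 * (2 + t))) := by
  rw [dispersionNats_mul_div ht hr]
  field_simp
  ring

lemma dispersionNats_mul_div_le_tangent (ht : 0 < t) (hr : 0 ≤ r) :
    dispersionNats (t * r) / dispersionNats t ≤ 1 + 2 / ((1 + t) * (2 + t)) * (r - 1) := by
  rw [← sub_nonneg, tangent_sub_dispersionNats_mul_div ht hr]
  positivity

lemma tangent_sub_le_dispersionNats_mul_div (ht : 0 < t) (hr : 0 ≤ r) :
    1 + 2 / ((1 + t) * (2 + t)) * (r - 1) - 2 * (r - 1) ^ 2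
      ≤ dispersionNats (t * r) / dispersionNats t := by
  have htr : 0 ≤ t * r := by positivity
  have hcurv : t * (1 + t + 2 * (1 + t * r)) / ((1 + t) * (1 + t * r) ^ 2 * (2 + t)) ≤ 2 := by
    rw [div_le_iff₀ (by positivity)]
    have h1 : 1 + t + 2 * (1 + t * r) ≤ 2 * ((1 + t * r) ^ 2 * (2 + t)) := by
      nlinarith [mul_nonneg htr ht.le, mul_nonneg (sq_nonneg (t * r)) ht.le]
    calc t * (1 + t + 2 * (1 + t * r)) ≤ (1 + t) * (2 * ((1 + t * r) ^ 2 * (2 + t))) := by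
          gcongr
          linarith
      _ = 2 * ((1 + t) * (1 + t * r) ^ 2 * (2 + t)) := by ring
  have hgap := tangent_sub_dispersionNats_mul_div ht hr
  linarith [mul_le_mul_of_nonneg_left hcurv (sq_nonneg (r - 1))]

lemma one_add_div_two_sub_sq_le_sqrt (hx : 0 ≤ x) :
    1 + (x - 1) / 2 - (x - 1) ^ 2 / 2 ≤ √x := by
  obtain ⟨y, hy, rfl⟩ : ∃ y, 0 ≤ y ∧ y ^ 2 = x := ⟨√x, Real.sqrt_nonneg x, Real.sq_sqrt hx⟩
  rw [Real.sqrt_sq hy]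
  nlinarith [mul_nonneg (sq_nonneg (y - 1)) (mul_nonneg hy (by linarith : 0 ≤ y + 2))]

lemma sqrt_dispersionNats_mul (ht : 0 < t) (r : ℝ) :
    √(dispersionNats (t * r))
      = √(dispersionNats t) * √(dispersionNats (t * r) / dispersionNats t) := by
  rw [← Real.sqrt_mul (dispersionNats_pos ht).le, mul_div_cancel₀ _ (dispersionNats_pos ht).ne']

lemma sqrt_dispersionNats_mul_le_tangent (ht : 0 < t) (hr : 0 ≤ r) :
    √(dispersionNats (t * r)) ≤ √(dispersionNats t) * (1 + (r - 1) / ((1 + t) * (2 + t))) := by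
  have hq : 0 ≤ dispersionNats (t * r) / dispersionNats t :=
    div_nonneg (dispersionNats_nonneg (by positivity)) (dispersionNats_pos ht).le
  have htan := dispersionNats_mul_div_le_tangent ht hr
  rw [sqrt_dispersionNats_mul ht]
  gcongr
  have hsqrt := Real.sqrt_one_add_le (show -1 ≤ dispersionNats (t * r) / dispersionNats t - 1 by
    linarith)
  rw [add_sub_cancel] at hsqrt
  linear_combination hsqrt + htan / 2

lemma tangent_sub_le_sqrt_dispersionNats_mul (ht : 0 < t) (hr : 0 ≤ r) :
    √(dispersionNats t) * (1 + (r - 1) / ((1 + t) * (2 + t)) - 3 / 2 * (r - 1) ^ 2)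
      ≤ √(dispersionNats (t * r)) := by
  have hq : 0 ≤ dispersionNats (t * r) / dispersionNats t :=
    div_nonneg (dispersionNats_nonneg (by positivity)) (dispersionNats_pos ht).le
  have htan := tangent_sub_le_dispersionNats_mul_div ht hr
  have hsq := dispersionNats_mul_div_sub_one_sq_le ht hr
  rw [sqrt_dispersionNats_mul ht]
  gcongr
  linear_combination one_add_div_two_sub_sq_le_sqrt hq + htan / 2 + hsq / 2

lemma integrable_sqrt_dispersionNats [IsFiniteMeasure μ] (hX : AEMeasurable X μ) :
    Integrable (fun ω ↦ √(dispersionNats (X ω))) μ := by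
  refine Integrable.of_bound (C := 1)
    (measurable_dispersionNats.comp_aemeasurable hX).sqrt.aestronglyMeasurable
    (ae_of_all _ fun ω ↦ ?_)
  rw [Real.norm_of_nonneg (Real.sqrt_nonneg _)]
  exact Real.sqrt_le_one.2 (dispersionNats_le_one _)

lemma sqrt_dispersion_div (T : ℕ) (x : ℝ) :
    √(1 / (T : ℝ) * dispersion x)
      = √(1 / (T : ℝ)) * (1 / Real.log 2) * √(dispersionNats x) := by
  rw [dispersion_eq, ← mul_assoc, Real.sqrt_mul (by positivity), Real.sqrt_mul (by positivity),
    Real.sqrt_sq (by positivity)]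

lemma integrable_sqrt_dispersion_mul [IsFiniteMeasure μ] (hX : AEMeasurable X μ) (T : ℕ) (q : ℝ) :
    Integrable (fun ω ↦ √(1 / (T : ℝ) * dispersion (X ω)) * q) μ := by
  simp_rw [sqrt_dispersion_div]
  exact ((integrable_sqrt_dispersionNats hX).const_mul _).mul_const q

lemma integral_sqrt_dispersionNats_le [IsProbabilityMeasure μ] (hX : Integrable X μ)
    (h0 : 0 ≤ᵐ[μ] X) (hmean : 0 < μ[X]) (hγ : 0 < γ) :
    ∫ ω, √(dispersionNats (γ * X ω)) ∂μ ≤ √(dispersionNats (γ * μ[X])) := by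
  let M := μ[X]
  have ht : 0 < γ * M := mul_pos hγ hmean
  let tangent (ω : Ω) : ℝ :=
    √(dispersionNats (γ * M)) * (1 + (X ω / M - 1) / ((1 + γ * M) * (2 + γ * M)))
  have hle : ∀ᵐ ω ∂μ, √(dispersionNats (γ * X ω)) ≤ tangent ω := by
    filter_upwards [h0] with ω hω
    have h := sqrt_dispersionNats_mul_le_tangent ht (div_nonneg hω hmean.le)
    rwa [mul_assoc, mul_div_cancel₀ _ hmean.ne'] at h
  have hint : Integrable tangent μ := by fun_prop
  refine (integral_mono_ae (integrable_sqrt_dispersionNats (hX.const_mul γ).aemeasurable)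
    hint hle).trans_eq ?_
  simp only [tangent]
  rw [integral_const_mul, integral_add (by fun_prop) (by fun_prop), integral_div,
    integral_sub (by fun_prop) (by fun_prop), integral_div]
  simp [M, hmean.ne']

lemma le_integral_sqrt_dispersionNats [IsProbabilityMeasure μ] (hX : MemLp X 2 μ)
    (h0 : 0 ≤ᵐ[μ] X) (hmean : 0 < μ[X]) (hγ : 0 < γ) :
    √(dispersionNats (γ * μ[X])) * (1 - 3 / 2 * (Var[X; μ] / μ[X] ^ 2))
      ≤ ∫ ω, √(dispersionNats (γ * X ω)) ∂μ := by
  let M := μ[X]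
  have ht : 0 < γ * M := mul_pos hγ hmean
  have hX1 : Integrable X μ := hX.integrable one_le_two
  let parabola (ω : Ω) : ℝ := √(dispersionNats (γ * M)) *
    (1 + (X ω / M - 1) / ((1 + γ * M) * (2 + γ * M)) - 3 / 2 * ((X ω - M) ^ 2 / M ^ 2))
  have hle : ∀ᵐ ω ∂μ, parabola ω ≤ √(dispersionNats (γ * X ω)) := by
    filter_upwards [h0] with ω hω
    have h := tangent_sub_le_sqrt_dispersionNats_mul ht (div_nonneg hω hmean.le)
    rwa [mul_assoc, mul_div_cancel₀ _ hmean.ne', div_sub_one hmean.ne', div_pow,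
      ← div_sub_one hmean.ne'] at h
  have hsq : Integrable (fun ω ↦ (X ω - M) ^ 2) μ := (hX.sub (memLp_const M)).integrable_sq
  have hint : Integrable parabola μ := by fun_prop
  refine Eq.trans_le ?_ (integral_mono_ae hint
    (integrable_sqrt_dispersionNats (hX1.const_mul γ).aemeasurable) hle)
  simp only [parabola]
  rw [integral_const_mul, integral_sub (by fun_prop) (by fun_prop),
    integral_add (by fun_prop) (by fun_prop), integral_const_mul, integral_div, integral_div,
    integral_sub (by fun_prop) (by fun_prop), integral_div, variance_eq_integral hX1.aemeasurable]
  simp [M, hmean.ne']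

lemma integral_sqrt_dispersionNats_gammaMeasure_mem_Icc (ha : 0 < a) (hγ : 0 < γ) :
    ∫ x, √(dispersionNats (γ * x)) ∂gammaMeasure a 1
      ∈ Set.Icc (√(dispersionNats (γ * a)) * (1 - 3 / 2 / a)) √(dispersionNats (γ * a)) := by
  have := isProbabilityMeasure_gammaMeasure ha one_pos
  have hmean : (gammaMeasure a 1)[id] = a := by rw [integral_id_gammaMeasure ha one_pos, div_one]
  have hvar : Var[id; gammaMeasure a 1] = a := by
    rw [variance_id_gammaMeasure ha one_pos, one_pow, div_one]
  have hX := memLp_id_gammaMeasure ha one_pos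
  have h0 := ae_nonneg_gammaMeasure a 1
  have hlow := le_integral_sqrt_dispersionNats hX h0 (by rwa [hmean]) hγ
  have hupp := integral_sqrt_dispersionNats_le (hX.integrable one_le_two) h0 (by rwa [hmean]) hγ
  rw [hmean] at hlow hupp
  refine ⟨le_trans (le_of_eq ?_) hlow, hupp⟩
  rw [hvar]
  field_simp

end DispersionTerm

section LaplaceApproximation

variable {Ω : Type*} [MeasurableSpace Ω] {μ : Measure Ω} {X : Ω → ℝ} {N n : ℕ} {a γ : ℝ}

lemma log_stirlingSeq_le (hn : n ≠ 0) :
    Real.log (Stirling.stirlingSeq n) ≤ Real.log √Real.pi + 1 / (12 * n) := by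
  obtain ⟨k, rfl⟩ := Nat.exists_eq_succ_of_ne_zero hn
  let f (k : ℕ) : ℝ := Real.log (Stirling.stirlingSeq (k + 1)) - 1 / (12 * (k + 1 : ℕ))
  have hmono : Monotone f := by
    refine monotone_nat_of_le_succ fun j ↦ ?_
    have hdiff := Stirling.log_stirlingSeq_sdiff_le (j + 1)
    have htelescope : (1 : ℝ) / (12 * (j + 1 : ℕ) * ((j + 1 : ℕ) + 1))
        = 1 / (12 * (j + 1 : ℕ)) - 1 / (12 * (j + 1 + 1 : ℕ)) := by
      push_cast
      field_simp
      ring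
    simp only [f]
    linarith
  have hlim : Filter.Tendsto f Filter.atTop (nhds (Real.log √Real.pi - 0)) := by
    have hseq := (Filter.tendsto_add_atTop_iff_nat 1).2 Stirling.tendsto_stirlingSeq_sqrt_pi
    refine (hseq.log (by positivity)).sub ?_
    convert! (tendsto_one_div_add_atTop_nhds_zero_nat (𝕜 := ℝ)).const_mul (1 / 12) using 2
    · push_cast
      field_simp
    · simp
  have hle := hmono.ge_of_tendsto hlim k
  simp only [f, sub_zero] at hle
  exact sub_le_iff_le_add.1 hle

lemma factorial_le_exp_mul_stirling (hn : n ≠ 0) :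
    (n.factorial : ℝ)
      ≤ Real.exp (1 / (12 * n)) * (√(2 * Real.pi * n) * (n / Real.exp 1) ^ n) := by
  have hpos : 0 < Stirling.stirlingSeq n :=
    (by positivity : 0 < √Real.pi).trans_le (Stirling.sqrt_pi_le_stirlingSeq hn)
  have hle : Stirling.stirlingSeq n ≤ √Real.pi * Real.exp (1 / (12 * n)) := by
    rw [← Real.log_le_log_iff hpos (by positivity), Real.log_mul (by positivity) (by positivity),
      Real.log_exp]
    exact log_stirlingSeq_le hn
  rw [Stirling.stirlingSeq, div_le_iff₀ (by positivity)] at hle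
  refine hle.trans_eq ?_
  rw [mul_right_comm 2, Real.sqrt_mul (x := 2 * n) (by positivity)]
  ring

lemma exists_factorial_eq_mul_stirling (hn : n ≠ 0) :
    ∃ c ∈ Set.Icc (1 : ℝ) (1 + 1 / (6 * n)),
      (n.factorial : ℝ) = c * (√(2 * Real.pi * n) * (n / Real.exp 1) ^ n) := by
  have hn1 : (1 : ℝ) ≤ n := by exact_mod_cast Nat.one_le_iff_ne_zero.2 hn
  have hpos : 0 < √(2 * Real.pi * n) * (n / Real.exp 1) ^ n := by positivity
  have hx0 : (0 : ℝ) ≤ 1 / (12 * n) := by positivity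
  have hx1 : 1 / (12 * (n : ℝ)) ≤ 1 := (div_le_one (by positivity)).2 (by linarith)
  refine ⟨n.factorial / (√(2 * Real.pi * n) * (n / Real.exp 1) ^ n),
    ⟨(one_le_div hpos).2 (Stirling.le_factorial_stirling n), ?_⟩,
    (div_mul_cancel₀ _ hpos.ne').symm⟩
  have hexp := Real.abs_exp_sub_one_le (by rwa [abs_of_nonneg hx0])
  rw [abs_of_nonneg hx0] at hexp
  calc n.factorial / (√(2 * Real.pi * n) * (n / Real.exp 1) ^ n)
      ≤ Real.exp (1 / (12 * n)) := (div_le_iff₀ hpos).2 (factorial_le_exp_mul_stirling hn)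
    _ ≤ 1 + 2 * (1 / (12 * n)) := by linarith [le_abs_self (Real.exp (1 / (12 * n)) - 1)]
    _ = 1 + 1 / (6 * n) := by
        field_simp
        ring

lemma Psi_succ (ε γ : ℝ) (n T : ℕ) :
    Psi ε γ (n + 1) T
      = √(1 / (T : ℝ)) * (1 / Real.log 2) * √(dispersionNats (γ * n)) * gaussQInv ε *
          (√(2 * Real.pi * n) * (n / Real.exp 1) ^ n / n.factorial) := by
  have hpow : (n : ℝ) ^ ((n : ℝ) + 1 - 1 / 2) = √n * n ^ n := by
    rw [show (n : ℝ) + 1 - 1 / 2 = 1 / 2 + n by ring,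
      Real.rpow_add_natCast' (by positivity) (by positivity), Real.sqrt_eq_rpow]
  have hexp : Real.exp (-(n : ℝ)) = (Real.exp 1 ^ n)⁻¹ := by
    rw [Real.exp_neg, ← Real.exp_nat_mul, mul_one]
  rw [Psi, Nat.cast_add, Nat.cast_one, Real.Gamma_nat_eq_factorial, add_sub_cancel_right, hpow,
    hexp, ← mul_one_div (2 * Real.pi), Real.sqrt_mul (by positivity),
    Real.sqrt_mul (x := 2 * Real.pi) (by positivity), dispersionNats, div_pow]
  ring

lemma sqrt_dispersionNats_mem_Icc (ha : 1 < a) (hγ : 0 < γ) :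
    √(dispersionNats (γ * a)) ∈ Set.Icc (√(dispersionNats (γ * (a - 1))))
      (√(dispersionNats (γ * (a - 1))) * (1 + 1 / (2 * (a - 1)))) := by
  have ha1 : 0 < a - 1 := sub_pos.2 ha
  have ht : 0 < γ * (a - 1) := mul_pos hγ ha1
  constructor
  · unfold dispersionNats
    gcongr
    linarith
  · have h := sqrt_dispersionNats_mul_le_tangent ht (r := a / (a - 1)) (by positivity)
    rw [mul_assoc, mul_div_cancel₀ _ ha1.ne', div_sub_one ha1.ne', sub_sub_cancel, div_div] at h
    refine h.trans ?_
    rw [mul_comm 2]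
    gcongr
    nlinarith

lemma exists_integral_sqrt_dispersionNats_eq_mul (ha : 2 ≤ a) (hγ : 0 < γ) :
    ∃ c ∈ Set.Icc (1 - 3 / 2 / a) (1 + 1 / (2 * (a - 1))),
      ∫ x, √(dispersionNats (γ * x)) ∂gammaMeasure a 1
        = c * √(dispersionNats (γ * (a - 1))) := by
  have hmode : 0 < √(dispersionNats (γ * (a - 1))) :=
    Real.sqrt_pos.2 (dispersionNats_pos (mul_pos hγ (by linarith)))
  have ha' : 0 ≤ 1 - 3 / 2 / a := sub_nonneg.2 ((div_le_one (by linarith)).2 (by linarith))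
  obtain ⟨hlow, hupp⟩ :=
    integral_sqrt_dispersionNats_gammaMeasure_mem_Icc (show 0 < a by linarith) hγ
  obtain ⟨hmono, htan⟩ := sqrt_dispersionNats_mem_Icc (show 1 < a by linarith) hγ
  refine ⟨(∫ x, √(dispersionNats (γ * x)) ∂gammaMeasure a 1) / √(dispersionNats (γ * (a - 1))),
    ⟨?_, (div_le_iff₀' hmode).2 (hupp.trans htan)⟩, (div_mul_cancel₀ _ hmode.ne').symm⟩
  rw [le_div_iff₀' hmode]
  exact (mul_le_mul_of_nonneg_right hmono ha').trans hlow

lemma abs_mul_sub_one_le {b c : ℝ} (ha : 2 ≤ a)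
    (hb : b ∈ Set.Icc (1 - 3 / 2 / a) (1 + 1 / (2 * (a - 1))))
    (hc : c ∈ Set.Icc 1 (1 + 1 / (6 * (a - 1)))) : |b * c - 1| ≤ 3 / 2 / a := by
  have ha1 : 1 ≤ a - 1 := by linarith
  have hb0 : 0 ≤ b :=
    (sub_nonneg.2 ((div_le_one (by linarith)).2 (by linarith))).trans hb.1
  have hupp : (1 + 1 / (2 * (a - 1))) * (1 + 1 / (6 * (a - 1))) ≤ 1 + 3 / 2 / a := by
    field_simp
    nlinarith
  rw [abs_sub_le_iff]
  constructor
  · linarith [mul_le_mul hb.2 hc.2 (zero_le_one.trans hc.1) (by positivity)]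
  · linarith [le_mul_of_one_le_right hb0 hc.1, hb.1]

lemma exists_integral_sqrt_dispersion_eq_mul_Psi (hN : 2 ≤ N) (hγ : 0 < γ) (ε : ℝ) (T : ℕ) :
    ∃ δ : ℝ, |δ| ≤ 3 / 2 / N ∧
      ∫ x, √(1 / (T : ℝ) * dispersion (γ * x)) * gaussQInv ε ∂gammaMeasure N 1
        = (1 + δ) * Psi ε γ N T := by
  obtain ⟨n, rfl⟩ := Nat.exists_eq_add_of_le' (one_le_two.trans hN)
  have hn : n ≠ 0 := by lia
  have hN' : (2 : ℝ) ≤ (n + 1 : ℕ) := by exact_mod_cast hN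
  have hcast : ((n + 1 : ℕ) : ℝ) - 1 = n := by push_cast; ring
  obtain ⟨b, hb, hint⟩ := exists_integral_sqrt_dispersionNats_eq_mul hN' hγ
  obtain ⟨c, hc, hfact⟩ := exists_factorial_eq_mul_stirling hn
  have hc0 : c ≠ 0 := (one_pos.trans_le hc.1).ne'
  refine ⟨b * c - 1, abs_mul_sub_one_le hN' hb (by rwa [hcast]), ?_⟩
  simp_rw [sqrt_dispersion_div]
  rw [integral_mul_const, integral_const_mul, hint, hcast, Psi_succ, hfact]
  field_simp
  ring

lemma exists_integral_sqrt_dispersion_of_hasLaw (hX : HasLaw X (gammaMeasure N 1) μ) (hN : 2 ≤ N)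
    (hγ : 0 < γ) (ε : ℝ) (T : ℕ) :
    ∃ δ : ℝ, |δ| ≤ 3 / 2 / N ∧
      ∫ ω, √(1 / (T : ℝ) * dispersion (γ * X ω)) * gaussQInv ε ∂μ = (1 + δ) * Psi ε γ N T := by
  obtain ⟨δ, hδ, hΨ⟩ := exists_integral_sqrt_dispersion_eq_mul_Psi hN hγ ε T
  have hm : Measurable fun x ↦ √(1 / (T : ℝ) * dispersion (γ * x)) * gaussQInv ε := by
    unfold dispersion
    fun_prop
  exact ⟨δ, hδ, (hX.integral_comp hm.aestronglyMeasurable).trans hΨ⟩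

end LaplaceApproximation

end ChannelTraining

end

theorem theorem2 :
    ∃ K : ℝ, 0 < K ∧
      ∀ (N Ttr T : ℕ) (P : ℝ) (σsq : ℝ≥0) (ε : ℝ),
        1 ≤ N → N ≤ Ttr → Ttr ≤ T → 0 < P → 0 < σsq → 0 < ε → ε < 1 →
      ∀ (Ω : Type*) [MeasurableSpace Ω] (μ : Measure Ω) [IsProbabilityMeasure μ]
        (S : Matrix (Fin N) (Fin Ttr) ℂ) (h : Ω → Fin N → ℂ) (nd : Ω → Fin Ttr → ℂ)
        (u n : Ω → ℂ), IsDownlinkModel μ σsq S h nd u n →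
      -- `σ²_ĥ` and `σ²_ê` are the variances of the entries of the estimate and of the error
      (∀ j, complexVariance (fun ω => estimate P σsq S (h ω) (nd ω) j) μ
          = estimateVar N Ttr P σsq) ∧
      (∀ j, complexVariance (fun ω => estimationError P σsq S (h ω) (nd ω) j) μ
          = errorVar N Ttr P σsq) ∧
      -- the expectations exist
      Integrable (fun ω => capacity (sinr μ P σsq S h nd u n ω)) μ ∧
      Integrable (fun ω =>
        Real.sqrt (1 / (T : ℝ) * dispersion (sinr μ P σsq S h nd u n ω)) * gaussQInv ε) μ ∧
      -- the capacity term is exactly `Φ`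
      ((∫ ω, capacity (sinr μ P σsq S h nd u n ω) ∂μ : ℝ) : ℂ)
          = Phi (effectiveSNR N Ttr P σsq) N ∧
      -- the dispersion term is `Ψ` up to a relative error `O(1 / N)`, uniformly in all parameters
      (2 ≤ N → ∃ δ : ℝ, |δ| ≤ K / N ∧
        ∫ ω, Real.sqrt (1 / (T : ℝ) * dispersion (sinr μ P σsq S h nd u n ω)) * gaussQInv ε ∂μ
          = (1 + δ) * Psi ε (effectiveSNR N Ttr P σsq) N T ∧
        ((downlinkRate μ T ε P σsq S h nd u n : ℝ) : ℂ)
          = (1 - (Ttr : ℂ) / T) *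
              (Phi (effectiveSNR N Ttr P σsq) N
                - (1 + δ) * Psi ε (effectiveSNR N Ttr P σsq) N T)) := by
  refine ⟨3 / 2, by norm_num, ?_⟩
  intro N Ttr T P σsq ε hN hNT _ hP hσ _ _ Ω _ μ _ S h nd u n hm
  have hΛ := pilotPower_pos hN hNT hP
  have hγ := effectiveSNR_pos hP hσ hΛ
  obtain ⟨X, hX, hsinr⟩ := hm.exists_hasLaw_gammaMeasure_sinr_eq hN hP.le hσ hΛ
  have hcap_int := integrable_capacity_of_hasLaw hX hN hγ.le
  have hdisp_int := integrable_sqrt_dispersion_mul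
    (hX.aemeasurable.const_mul (effectiveSNR N Ttr P σsq)) T (gaussQInv ε)
  have hcap := integral_capacity_of_hasLaw hX hN hγ
  simp only [downlinkRate, hsinr]
  refine ⟨hm.complexVariance_estimate hΛ, hm.complexVariance_estimationError hΛ, hcap_int,
    hdisp_int, hcap, fun hN2 ↦ ?_⟩
  obtain ⟨δ, hδ, hdisp⟩ := exists_integral_sqrt_dispersion_of_hasLaw hX hN2 hγ ε T
  refine ⟨δ, hδ, hdisp, ?_⟩
  rw [integral_sub hcap_int hdisp_int, hdisp, ← hcap]
  push_cast
  rfl
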